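/- Let $\mathcal G$ be a connected undirected (unweighted) graph on the nodes $1,\dots,N$, $N\ge 2$, with Laplacian matrix $L$, whose eigenvalues are $0=\lambda_1<\lambda_2\le\dots\le\lambda_N$. Let $R'\in\mathbb R^{N\times N}$ be any orthogonal matrix with $R'L{R'}^\top=\operatorname{diag}(\lambda_1,\dots,\lambda_N)$, let $R\in\mathbb R^{(N-1)\times N}$ be $R'$ without its first row, and put $\Lambda=\operatorname{diag}(\lambda_2,\dots,\lambda_N)$, $\bar A^*=(\Lambda R)\otimes I_n$ and $V=\operatorname{diag}(I_{nN},R\otimes I_n)$. For $i=1,\dots,N$ let $f_i:\mathbb R^n\times\mathbb R_{\ge0}\to\mathbb R$ be such that, for all $t\ge 0$, $x\mapsto f_i(x,t)$ is twice continuously differentiable, strongly convex with constant $\ell_{\inf,i}>0$ and Lipschitz smooth with constant $\ell_{\sup,i}>0$ (both independent of $t$), and such that, for all $x$, $t\mapsto\nabla f_i(x,t)$ is continuously differentiable on $[0,\infty)$; here $\nabla$ is the gradient in $x$. Put $\ell_{\inf}=(\ell_{\inf,1},\dots,\ell_{\inf,N})$ and $\ell_{\sup}=(\ell_{\sup,1},\dots,\ell_{\sup,N})$.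 Consider the problem $$\min_{\mathbf x=(x^1,\dots,x^N)\in\mathbb R^{nN}}\ \sum_{i=1}^N f_i(x^i,t)\quad\text{subject to}\quad (L\otimes I_n)\mathbf x=0$$ and its primal-dual dynamics $$\dot x^i=-\nabla f_i(x^i,t)-\sum_{j\in\mathcal N_i}(\nu^i-\nu^j),\qquad \dot\nu^i=\sum_{j\in\mathcal N_i}(x^i-x^j),\qquad i=1,\dots,N,$$ that is, $\dot{\mathbf x}=-(\nabla f_i(x^i,t))_{i}-(L\otimes I_n)\nu$, $\dot\nu=(L\otimes I_n)\mathbf x$. Write the dynamics as $(\dot{\mathbf x},\dot\nu)=F(t,(\mathbf x,\nu))$. For $t\ge0$ let $\mathbf x^*(t)=\mathbf 1_N\otimes x^*(t)$, where $x^*(t)$ is the minimizer of $x\mapsto\sum_i f_i(x,t)$, and let $\nu^*(t)$ be any optimal dual variable (Lagrange multiplier) of the problem at time $t$. For $0<\epsilon<1$ put $$\tilde\alpha_\epsilon=\frac{\epsilon\,\min_i\ell_{\inf,i}}{\lambda_N^2+\frac34\lambda_N\lambda_2^2+\|\ell_{\sup}\|_\infty^2},\qquad \tilde P=\begin{bmatrix}I_{nN}&\tilde\alpha_\epsilon\bar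 A^{*\top}\\ \tilde\alpha_\epsilon\bar A^*&I_{n(N-1)}\end{bmatrix},\qquad c=\tilde\alpha_\epsilon\,\frac34\,\frac{\lambda_2^2}{\lambda_N+1},$$ and $\|v\|_{2,\tilde P^{1/2}}=\|\tilde P^{1/2}v\|_2$. Then $\tilde P$ is positive definite; for each $t\ge0$, $x^*(t)$ exists and is unique and an optimal dual variable $\nu^*(t)$ exists; and the following hold. 1. For every solution $(\mathbf x,\nu)$ of the dynamics on $[0,\infty)$, $z(t)=V(\mathbf x(t),\nu(t))$ solves the system $\dot z=VF(t,V^\top z)$. This system is contractive with respect to $\|\cdot\|_{2,\tilde P^{1/2}}$ with rate $c>0$: for every $t_0\ge0$ it has a trajectory on $[t_0,\infty)$ from each initial condition at time $t_0$, and any two trajectories $z,w$ on $[t_0,\infty)$ satisfy $\|z(t)-w(t)\|_{2,\tilde P^{1/2}}\le\|z(t_0)-w(t_0)\|_{2,\tilde P^{1/2}}\,e^{-c(t-t_0)}$ for $t\ge t_0$. 2. Suppose that there are positive constants $\beta_{1,i}$ such that $\|\tfrac{\partial}{\partial t}\nabla f_i(x,t)\|_2\le\beta_{1,i}$ for all $x\in\mathbb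 R^n$, $t\ge0$ and all $i$, and put $\beta_1=(\beta_{1,1},\dots,\beta_{1,N})$. Then, for every solution $(\mathbf x,\nu)$ of the dynamics on $[0,\infty)$, $z(t)=V(\mathbf x(t),\nu(t))$ and $z^*(t)=V(\mathbf x^*(t),\nu^*(t))$ satisfy, for all $t\ge0$, $$\|z(t)-z^*(t)\|_{2,\tilde P^{1/2}}\le\Big(\|z(0)-z^*(0)\|_{2,\tilde P^{1/2}}-\frac{\rho}{c}\Big)e^{-ct}+\frac{\rho}{c},$$ so that the tracking error is asymptotically bounded by $\rho/c$ (for every $\eta>0$ it is eventually at most $\rho/c+\eta$), where $$\rho=\lambda_{\max}(\tilde P)\frac{\|\beta_1\|_1}{\|\ell_{\inf}\|_1}N+\lambda_{\max}(\tilde P)\frac{\|\beta_1\|_1}{\lambda_2}\Big(\frac{\|\ell_{\sup}\|_\infty}{\|\ell_{\inf}\|_1}+1\Big).$$ -/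

import Mathlib

open scoped Kronecker MatrixOrder

noncomputable section

namespace TVDistOpt

/-! ### Matrices and weighted norms -/

/-- Largest eigenvalue of a square matrix all of whose eigenvalues are real. -/
def lambdaMax {ι : Type*} [Fintype ι] [DecidableEq ι] (A : Matrix ι ι ℝ) : ℝ :=
  sSup (spectrum ℝ A)

/-- The weighted Euclidean norm `‖v‖_{2,Q} = ‖Q v‖₂`. -/
def weightedNorm {ι : Type*} [Fintype ι] (Q : Matrix ι ι ℝ) (v : ι → ℝ) : ℝ :=
  ‖(WithLp.toLp 2 (Q.mulVec v) : EuclideanSpace ℝ ι)‖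

/-- The weighted norm `‖v‖_{2,P^{1/2}}`; `CFC.sqrt P` is the positive semidefinite square root
of a positive semidefinite matrix `P`. -/
def sqrtNorm {ι : Type*} [Fintype ι] [DecidableEq ι] (P : Matrix ι ι ℝ) (v : ι → ℝ) : ℝ :=
  weightedNorm (CFC.sqrt P) v

/-! ### Trajectories and contraction -/

/-- `u` solves `u' = F t u` on `[t₀, ∞)`. -/
def IsTrajectory {ι : Type*} [Fintype ι] (F : ℝ → (ι → ℝ) → (ι → ℝ)) (t₀ : ℝ)
    (u : ℝ → ι → ℝ) : Prop :=
  ∀ t ∈ Set.Ici t₀, HasDerivWithinAt u (F t (u t)) (Set.Ici t₀) t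

/-- The system `u' = F t u`, `t ≥ 0`, is contractive with rate `c > 0` with respect to `nrm`:
from each initial condition there is a trajectory for all later times, and any two trajectories
approach each other exponentially with rate `c` (in particular trajectories are unique). -/
def IsContractive {ι : Type*} [Fintype ι] (F : ℝ → (ι → ℝ) → (ι → ℝ))
    (nrm : (ι → ℝ) → ℝ) (c : ℝ) : Prop :=
  0 < c ∧
  (∀ t₀ : ℝ, 0 ≤ t₀ → ∀ u₀ : ι → ℝ, ∃ u : ℝ → ι → ℝ, IsTrajectory F t₀ u ∧ u t₀ = u₀) ∧
  ∀ t₀ : ℝ, 0 ≤ t₀ → ∀ u v : ℝ → ι → ℝ, IsTrajectory F t₀ u → IsTrajectory F t₀ v →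
    ∀ t : ℝ, t₀ ≤ t → nrm (u t - v t) ≤ nrm (u t₀ - v t₀) * Real.exp (-c * (t - t₀))

/-! ### The graph Laplacian and its eigendecomposition -/

/-- The eigenvalues of the Laplacian of `G` listed with multiplicity in nondecreasing order:
index `k : Fin N` is the eigenvalue usually written `λ_{k+1}`. -/
def lapEigenvalue {N : ℕ} (G : SimpleGraph (Fin N)) [DecidableRel G.Adj] (k : Fin N) : ℝ :=
  (SimpleGraph.isHermitian_lapMatrix (R := ℝ) G).eigenvalues₀
    (Fin.cast (Fintype.card_fin N).symm k.rev)

/-- `λ₂`, for a graph with at least two vertices. -/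
def lambdaTwo {N : ℕ} (hN : 2 ≤ N) (G : SimpleGraph (Fin N)) [DecidableRel G.Adj] : ℝ :=
  lapEigenvalue G ⟨1, by omega⟩

/-- `λ_N`, the largest eigenvalue of the Laplacian. -/
def lambdaN {N : ℕ} (hN : 2 ≤ N) (G : SimpleGraph (Fin N)) [DecidableRel G.Adj] : ℝ :=
  lapEigenvalue G ⟨N - 1, by omega⟩

/-- The position of `k : Fin (N - 1)` in `Fin N` when the first index is skipped. -/
def tailIdx {N : ℕ} (k : Fin (N - 1)) : Fin N := ⟨k + 1, by omega⟩

/-- `T` is orthogonal and `T L Tᵀ = diag(λ₁, …, λ_N)` with `λ₁ ≤ … ≤ λ_N`. -/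
def Diagonalizes {N : ℕ} (G : SimpleGraph (Fin N)) [DecidableRel G.Adj]
    (T : Matrix (Fin N) (Fin N) ℝ) : Prop :=
  T ∈ Matrix.orthogonalGroup (Fin N) ℝ ∧
    T * G.lapMatrix ℝ * T.transpose = Matrix.diagonal (lapEigenvalue G)

/-- `R`: the matrix `T` without its first row. -/
def dropFirstRow {N : ℕ} (T : Matrix (Fin N) (Fin N) ℝ) : Matrix (Fin (N - 1)) (Fin N) ℝ :=
  T.submatrix tailIdx id

/-- `Λ = diag(λ₂, …, λ_N)`. -/
def Lam {N : ℕ} (G : SimpleGraph (Fin N)) [DecidableRel G.Adj] :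
    Matrix (Fin (N - 1)) (Fin (N - 1)) ℝ :=
  Matrix.diagonal fun k => lapEigenvalue G (tailIdx k)

/-- `L ⊗ Iₙ`. -/
def lapKron {N : ℕ} (n : ℕ) (G : SimpleGraph (Fin N)) [DecidableRel G.Adj] :
    Matrix (Fin N × Fin n) (Fin N × Fin n) ℝ :=
  G.lapMatrix ℝ ⊗ₖ (1 : Matrix (Fin n) (Fin n) ℝ)

/-- `Ā* = (Λ R) ⊗ Iₙ`. -/
def Abar {N : ℕ} (n : ℕ) (G : SimpleGraph (Fin N)) [DecidableRel G.Adj]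
    (T : Matrix (Fin N) (Fin N) ℝ) : Matrix (Fin (N - 1) × Fin n) (Fin N × Fin n) ℝ :=
  (Lam G * dropFirstRow T) ⊗ₖ (1 : Matrix (Fin n) (Fin n) ℝ)

/-- `V = diag(I_{nN}, R ⊗ Iₙ)`. -/
def Vmat {N : ℕ} (n : ℕ) (T : Matrix (Fin N) (Fin N) ℝ) :
    Matrix ((Fin N × Fin n) ⊕ (Fin (N - 1) × Fin n)) ((Fin N × Fin n) ⊕ (Fin N × Fin n)) ℝ :=
  Matrix.fromBlocks 1 0 0 (dropFirstRow T ⊗ₖ (1 : Matrix (Fin n) (Fin n) ℝ))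

/-- `α̃_ε`. Here `‖lsup‖` is the supremum norm of the vector `lsup`. -/
def alphaTilde {N : ℕ} (hN : 2 ≤ N) (G : SimpleGraph (Fin N)) [DecidableRel G.Adj]
    (linf lsup : Fin N → ℝ) (ε : ℝ) : ℝ :=
  ε * (⨅ i, linf i) /
    (lambdaN hN G ^ 2 + 3 / 4 * lambdaN hN G * lambdaTwo hN G ^ 2 + ‖lsup‖ ^ 2)

/-- `P̃ = [I, α̃ Ā*ᵀ; α̃ Ā*, I]`. -/
def Ptilde {N : ℕ} (n : ℕ) (hN : 2 ≤ N) (G : SimpleGraph (Fin N)) [DecidableRel G.Adj]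
    (T : Matrix (Fin N) (Fin N) ℝ) (linf lsup : Fin N → ℝ) (ε : ℝ) :
    Matrix ((Fin N × Fin n) ⊕ (Fin (N - 1) × Fin n))
      ((Fin N × Fin n) ⊕ (Fin (N - 1) × Fin n)) ℝ :=
  Matrix.fromBlocks 1 (alphaTilde hN G linf lsup ε • (Abar n G T).transpose)
    (alphaTilde hN G linf lsup ε • Abar n G T) 1

/-- The contraction rate `c = α̃_ε (3/4) λ₂² / (λ_N + 1)`. -/
def rate {N : ℕ} (hN : 2 ≤ N) (G : SimpleGraph (Fin N)) [DecidableRel G.Adj]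
    (linf lsup : Fin N → ℝ) (ε : ℝ) : ℝ :=
  alphaTilde hN G linf lsup ε * (3 / 4) * (lambdaTwo hN G ^ 2 / (lambdaN hN G + 1))

/-- The constant `ρ`. -/
def rho {N : ℕ} (n : ℕ) (hN : 2 ≤ N) (G : SimpleGraph (Fin N)) [DecidableRel G.Adj]
    (T : Matrix (Fin N) (Fin N) ℝ) (linf lsup : Fin N → ℝ) (ε : ℝ) (β : Fin N → ℝ) : ℝ :=
  lambdaMax (Ptilde n hN G T linf lsup ε) * ((∑ i, |β i|) / ∑ i, |linf i|) * N +
    lambdaMax (Ptilde n hN G T linf lsup ε) * ((∑ i, |β i|) / lambdaTwo hN G) *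
      (‖lsup‖ / (∑ i, |linf i|) + 1)

/-! ### The time-varying optimization problem -/

/-- The gradient `∇ f(x, t)` with respect to `x`. -/
def gradAt {n : ℕ} (f : EuclideanSpace ℝ (Fin n) → ℝ → ℝ) (x : EuclideanSpace ℝ (Fin n))
    (t : ℝ) : EuclideanSpace ℝ (Fin n) :=
  gradient (fun y => f y t) x

/-- Standing assumptions on the local costs `f i x t`, `t ≥ 0`: twice continuous differentiability
in `x`, strong convexity with constant `linf i > 0` and Lipschitz smoothness with constant
`lsup i > 0`, both uniform in time, and continuous differentiability of the gradient in `t`. -/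
structure StandingAssumptions {n N : ℕ} (f : Fin N → EuclideanSpace ℝ (Fin n) → ℝ → ℝ)
    (linf lsup : Fin N → ℝ) : Prop where
  linf_pos : ∀ i, 0 < linf i
  lsup_pos : ∀ i, 0 < lsup i
  contDiff : ∀ i, ∀ t : ℝ, 0 ≤ t → ContDiff ℝ 2 fun x => f i x t
  strongConvex : ∀ i, ∀ t : ℝ, 0 ≤ t → ∀ x y : EuclideanSpace ℝ (Fin n),
    linf i * ‖x - y‖ ^ 2 ≤ inner ℝ (gradAt (f i) x t - gradAt (f i) y t) (x - y)
  lipschitzSmooth : ∀ i, ∀ t : ℝ, 0 ≤ t → ∀ x y : EuclideanSpace ℝ (Fin n),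
    ‖gradAt (f i) x t - gradAt (f i) y t‖ ≤ lsup i * ‖x - y‖
  contDiff_time : ∀ i, ∀ x : EuclideanSpace ℝ (Fin n),
    ContDiffOn ℝ 1 (fun t => gradAt (f i) x t) (Set.Ici 0)

/-- The block `x^i ∈ ℝⁿ` of a stacked vector `x ∈ ℝ^{nN}`. -/
def block {n N : ℕ} (x : Fin N × Fin n → ℝ) (i : Fin N) : EuclideanSpace ℝ (Fin n) :=
  WithLp.toLp 2 fun j => x (i, j)

/-- `1_N ⊗ v`. -/
def consensus {n : ℕ} (N : ℕ) (v : EuclideanSpace ℝ (Fin n)) : Fin N × Fin n → ℝ :=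
  fun p => v p.2

/-- The Lagrangian `∑ i, f_i(x^i, t) + νᵀ (L ⊗ Iₙ) x`. -/
def lagrangian {n N : ℕ} (G : SimpleGraph (Fin N)) [DecidableRel G.Adj]
    (f : Fin N → EuclideanSpace ℝ (Fin n) → ℝ → ℝ) (t : ℝ) (x ν : Fin N × Fin n → ℝ) : ℝ :=
  (∑ i, f i (block x i) t) + dotProduct ν ((lapKron n G).mulVec x)

/-- `v` minimizes `x ↦ ∑ i, f_i(x, t)` over `ℝⁿ`. -/
def IsOptimizer {n N : ℕ} (f : Fin N → EuclideanSpace ℝ (Fin n) → ℝ → ℝ) (t : ℝ)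
    (v : EuclideanSpace ℝ (Fin n)) : Prop :=
  IsMinOn (fun x => ∑ i, f i x t) Set.univ v

/-- `ν` is an optimal dual variable (Lagrange multiplier of the constraint `(L ⊗ Iₙ) x = 0`) at
time `t`: the optimal point `1_N ⊗ v` minimizes the Lagrangian `𝓛(·, ν)` over all of `ℝ^{nN}`. -/
def IsDualOptimizer {n N : ℕ} (G : SimpleGraph (Fin N)) [DecidableRel G.Adj]
    (f : Fin N → EuclideanSpace ℝ (Fin n) → ℝ → ℝ) (t : ℝ) (v : EuclideanSpace ℝ (Fin n))
    (ν : Fin N × Fin n → ℝ) : Prop :=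
  IsMinOn (fun x => lagrangian G f t x ν) Set.univ (consensus N v)

/-- The primal-dual dynamics: the state is `(x, ν)`, and
`x' = -∇f(x, t) - (L ⊗ Iₙ) ν`, `ν' = (L ⊗ Iₙ) x`. -/
def pdField {n N : ℕ} (G : SimpleGraph (Fin N)) [DecidableRel G.Adj]
    (f : Fin N → EuclideanSpace ℝ (Fin n) → ℝ → ℝ) (t : ℝ)
    (u : (Fin N × Fin n) ⊕ (Fin N × Fin n) → ℝ) : (Fin N × Fin n) ⊕ (Fin N × Fin n) → ℝ :=
  Sum.elim
    (fun p => -(gradAt (f p.1) (block (u ∘ Sum.inl) p.1) t) p.2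
      - (lapKron n G).mulVec (u ∘ Sum.inr) p)
    ((lapKron n G).mulVec (u ∘ Sum.inl))

/-- The vector field `z ↦ V F(t, Vᵀ z)` of the projected system, `F` being the primal-dual
vector field. -/
def projField {n N : ℕ} (G : SimpleGraph (Fin N)) [DecidableRel G.Adj]
    (T : Matrix (Fin N) (Fin N) ℝ) (f : Fin N → EuclideanSpace ℝ (Fin n) → ℝ → ℝ) (t : ℝ)
    (z : (Fin N × Fin n) ⊕ (Fin (N - 1) × Fin n) → ℝ) :
    (Fin N × Fin n) ⊕ (Fin (N - 1) × Fin n) → ℝ :=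
  (Vmat n T).mulVec (pdField G f t ((Vmat n T).transpose.mulVec z))

end TVDistOpt

end

/-! The dynamics see ν only through Lν, and L kills the first row of `T`, so nothing is lost by
passing to y = (R ⊗ I)ν. The system becomes x' = -∇f - Āᵀy, y' = Āx, where now ‖Āᵀy‖ ≥ λ₂‖y‖. In the
Euclidean norm this saddle system dissipates only in x. The off-diagonal blocks of P̃ add the term
-α̃‖Āᵀy‖², which dissipates in y; the price is α̃‖Āx‖² and a cross term between Āᵀy and the gradient
increment, and strong convexity pays for both because α̃ is small. The outcome is the one-sided
Lipschitz inequality ⟨F(z) - F(w), z - w⟩ ≤ -c‖z - w‖² in the P̃ inner product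
(`contraction_inequality`, `dotProduct_Ptilde_mulVec_le`). Grönwall turns it into exponential decay
(`tracking_bound`), and a Lipschitz constant uniform in time gives global trajectories.

For the tracking bound, z*(t) is a zero of the projected field at each fixed t, so the same
inequality compares z with z*. It remains to see that z* is ρ-Lipschitz in the P̃ norm. For the
primal part, the summed optimality conditions and strong monotonicity give speed ‖β‖₁/‖ℓinf‖₁. For
the dual part, stationarity equates Āᵀ(y*(t) - y*(s)) with minus the increment of the stacked
gradients. Baillon–Haddad cocoercivity (`norm_sq_gradient_sub_le`) bounds that increment without a
factor depending on N (`sum_norm_add_sq_le`), and dividing by λ₂ finishes. -/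

noncomputable section

namespace TVDistOpt

/-! ### Global existence for uniformly Lipschitz vector fields -/

section ODE

variable {E : Type*} [NormedAddCommGroup E] [NormedSpace ℝ E]

/-- `u' = F t u` on `[a, b]`. -/
def SolvesOn (F : ℝ → E → E) (a b : ℝ) (u : ℝ → E) : Prop :=
  ∀ t ∈ Set.Icc a b, HasDerivWithinAt u (F t (u t)) (Set.Icc a b) t

/-- Picard–Lindelöf on the ball of radius C/(K+1), with C a bound for ‖F t x₀‖: the speed there is
at most C + KC/(K+1) ≤ 2C, so time 1/(2(K+1)) is too short to leave the ball. This length does not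
depend on x₀, which is what allows iteration. -/
theorem exists_solvesOn_of_lipschitz [CompleteSpace E] {F : ℝ → E → E} {K : NNReal} {a b : ℝ}
    (hab : a ≤ b) (hb : b - a ≤ 1 / (2 * (K + 1)))
    (hlip : ∀ t ∈ Set.Icc a b, LipschitzWith K (F t))
    (hcont : ∀ x, ContinuousOn (fun t => F t x) (Set.Icc a b)) (x₀ : E) :
    ∃ u, SolvesOn F a b u ∧ u a = x₀ := by
  obtain ⟨C, hC⟩ := isCompact_Icc.exists_bound_of_continuousOn (hcont x₀)
  have hC0 : 0 ≤ C := (norm_nonneg _).trans (hC a ⟨le_rfl, hab⟩)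
  lift C to NNReal using hC0
  have hK : (0 : ℝ) ≤ K := K.2
  have hC0 : (0 : ℝ) ≤ C := C.2
  have hPL : IsPicardLindelof F (tmin := a) (tmax := b) ⟨a, le_rfl, hab⟩ x₀
      (C / (K + 1)) 0 (C + K * (C / (K + 1))) K := by
    refine ⟨fun t ht => (hlip t ht).lipschitzOnWith, fun x _ => hcont x, fun t ht x hx => ?_, ?_⟩
    · have h1 := (hlip t ht).norm_sub_le x x₀
      have h2 := hC t ht
      have h3 : ‖x - x₀‖ ≤ ((C / (K + 1) : NNReal) : ℝ) := by
        simpa [dist_eq_norm] using hx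
      calc ‖F t x‖ ≤ ‖F t x - F t x₀‖ + ‖F t x₀‖ := norm_le_norm_sub_add _ _
        _ ≤ K * ((C / (K + 1) : NNReal) : ℝ) + C := by
            gcongr
            exact h1.trans (by gcongr)
        _ = ((C + K * (C / (K + 1)) : NNReal) : ℝ) := by push_cast; ring
    · have h0 : max (b - a) (a - a) = b - a := by simp [hab]
      simp only [h0]
      push_cast
      calc ((C : ℝ) + K * (C / (K + 1))) * (b - a)
          ≤ ((C : ℝ) + K * (C / (K + 1))) * (1 / (2 * (K + 1))) := by gcongr
        _ ≤ ((C : ℝ) + (K + 1) * (C / (K + 1))) * (1 / (2 * (K + 1))) := by gcongr; linarith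
        _ = C / (K + 1) - 0 := by field_simp; ring
  obtain ⟨u, hu0, hu⟩ := hPL.exists_eq_forall_mem_Icc_hasDerivWithinAt₀
  exact ⟨u, hu, hu0⟩

theorem SolvesOn.glue {F : ℝ → E → E} {a b c : ℝ} {u w : ℝ → E} (hab : a ≤ b) (hbc : b ≤ c)
    (hu : SolvesOn F a b u) (hw : SolvesOn F b c w) (huw : w b = u b) :
    ∃ v, SolvesOn F a c v ∧ Set.EqOn v u (Set.Icc a b) := by
  classical
  set v : ℝ → E := fun s => if s ≤ b then u s else w s with hv
  have hvu : Set.EqOn v u (Set.Icc a b) := fun s hs => by simp [hv, hs.2]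
  have hvw : Set.EqOn v w (Set.Icc b c) := fun s hs => by
    rcases hs.1.eq_or_lt with h | h
    · subst h; simp [hv, huw]
    · simp [hv, h.not_ge]
  refine ⟨v, fun t ht => ?_, hvu⟩
  rw [← Set.Icc_union_Icc_eq_Icc hab hbc]
  refine HasDerivWithinAt.union ?_ ?_
  · by_cases h : t ∈ Set.Icc a b
    · rw [hvu h]
      exact (hu t h).congr hvu (hvu h)
    -- Away from the closed piece, a derivative within it is a vacuous condition.
    · exact HasFDerivWithinAt.of_notMem_closure (by rwa [isClosed_Icc.closure_eq])
  · by_cases h : t ∈ Set.Icc b c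
    · rw [hvw h]
      exact (hw t h).congr hvw (hvw h)
    · exact HasFDerivWithinAt.of_notMem_closure (by rwa [isClosed_Icc.closure_eq])

theorem exists_forall_hasDerivWithinAt_Ici [CompleteSpace E] {F : ℝ → E → E} {K : NNReal}
    {t₀ : ℝ} (hlip : ∀ t ∈ Set.Ici t₀, LipschitzWith K (F t))
    (hcont : ∀ x, ContinuousOn (fun t => F t x) (Set.Ici t₀)) (x₀ : E) :
    ∃ u : ℝ → E, (∀ t ∈ Set.Ici t₀, HasDerivWithinAt u (F t (u t)) (Set.Ici t₀) t) ∧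
      u t₀ = x₀ := by
  set h : ℝ := 1 / (2 * (K + 1)) with hh
  have hpos : 0 < h := by positivity
  have step : ∀ (k : ℕ) (u : ℝ → E), SolvesOn F t₀ (t₀ + k * h) u →
      ∃ v, SolvesOn F t₀ (t₀ + (k + 1 : ℕ) * h) v ∧
        Set.EqOn v u (Set.Icc t₀ (t₀ + k * h)) := by
    intro k u hu
    have h1 : t₀ ≤ t₀ + k * h := by have : 0 ≤ k * h := by positivity
                                    linarith
    have h2 : t₀ + k * h ≤ t₀ + (k + 1 : ℕ) * h := by push_cast; linarith
    have hsub : Set.Icc (t₀ + k * h) (t₀ + (k + 1 : ℕ) * h) ⊆ Set.Ici t₀ :=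
      fun s hs => h1.trans hs.1
    obtain ⟨w, hw, hw0⟩ := exists_solvesOn_of_lipschitz (K := K) h2
      (by push_cast; rw [← hh]; linarith) (fun t ht => hlip t (hsub ht))
      (fun x => (hcont x).mono hsub) (u (t₀ + k * h))
    exact hu.glue h1 h2 hw hw0
  have base : SolvesOn F t₀ (t₀ + (0 : ℕ) * h) (fun _ => x₀) := by
    intro t ht
    simp only [Nat.cast_zero, zero_mul, add_zero, Set.Icc_self] at ht ⊢
    have : t = t₀ := ht
    subst this
    exact HasFDerivWithinAt.singleton
  choose next hnext hagree using step
  -- Prolong by one step of length h at a time; consecutive solutions agree on the older interval,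
  -- so they patch to a single function.
  let sol : ∀ k : ℕ, {u : ℝ → E // SolvesOn F t₀ (t₀ + k * h) u} := fun k =>
    Nat.rec ⟨_, base⟩ (fun k u => ⟨next k u.1 u.2, hnext k u.1 u.2⟩) k
  have hsucc : ∀ k, Set.EqOn (sol (k + 1)).1 (sol k).1 (Set.Icc t₀ (t₀ + k * h)) :=
    fun k => hagree k (sol k).1 (sol k).2
  have hle : ∀ k m, k ≤ m → Set.EqOn (sol m).1 (sol k).1 (Set.Icc t₀ (t₀ + k * h)) := by
    intro k m hkm
    induction m, hkm using Nat.le_induction with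
    | base => exact fun _ _ => rfl
    | succ m hkm ih =>
      intro s hs
      have hkm' : (k : ℝ) ≤ m := by exact_mod_cast hkm
      rw [← ih hs]
      exact hsucc m ⟨hs.1, hs.2.trans (by gcongr)⟩
  have hex : ∀ t : ℝ, ∃ k : ℕ, t < t₀ + k * h := by
    intro t
    obtain ⟨k, hk⟩ := exists_nat_gt ((t - t₀) / h)
    exact ⟨k, by rw [div_lt_iff₀ hpos] at hk; linarith⟩
  choose idx hidx using hex
  have hu : ∀ k, Set.EqOn (fun t => (sol (idx t)).1 t) (sol k).1 (Set.Icc t₀ (t₀ + k * h)) := by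
    intro k s hs
    rcases le_total k (idx s) with hk | hk
    · exact hle _ _ hk hs
    · exact (hle _ _ hk ⟨hs.1, (hidx s).le⟩).symm
  refine ⟨fun t => (sol (idx t)).1 t, fun t ht => ?_, ?_⟩
  · have hmem : t ∈ Set.Icc t₀ (t₀ + idx t * h) := ⟨ht, (hidx t).le⟩
    have h1 := ((sol (idx t)).2 t hmem).congr (hu (idx t)) (hu (idx t) hmem)
    -- `t` lies strictly below the right end of its interval, so the interval and the half-line
    -- agree near `t`.
    refine h1.mono_of_mem_nhdsWithin ?_
    rw [← Set.Ici_inter_Iic]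
    exact Filter.inter_mem self_mem_nhdsWithin
      (mem_nhdsWithin_of_mem_nhds (Iic_mem_nhds (hidx t)))
  · exact hu 0 (by simp)

end ODE

/-! ### Exponential tracking of a Lipschitz curve -/

section Tracking

variable {E : Type*} [NormedAddCommGroup E] [InnerProductSpace ℝ E]

/-- The norm is not differentiable at 0, but along a curve that reaches 0 with zero velocity it is,
with derivative 0. This is the role of `hzero`. -/
theorem hasDerivWithinAt_norm_of_inner_le {δ : ℝ → E} {δ' : E} {s : Set ℝ} {t c : ℝ}
    (hδ : HasDerivWithinAt δ δ' s t) (hinner : inner ℝ δ' (δ t) ≤ -c * ‖δ t‖ ^ 2)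
    (hzero : δ t = 0 → δ' = 0) :
    ∃ g' ≤ -c * ‖δ t‖, HasDerivWithinAt (fun r => ‖δ r‖) g' s t := by
  by_cases h : δ t = 0
  · refine ⟨0, by simp [h], ?_⟩
    rw [hzero h, hasDerivWithinAt_iff_isLittleO] at hδ
    rw [hasDerivWithinAt_iff_isLittleO]
    simpa [h] using hδ.norm_left
  · have hpos : 0 < ‖δ t‖ := norm_pos_iff.mpr h
    refine ⟨inner ℝ (δ t) δ' / ‖δ t‖, ?_, ?_⟩
    · rw [div_le_iff₀ hpos, real_inner_comm]
      linarith [hinner]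
    · have h1 := hδ.norm_sq.sqrt (by positivity)
      simp only [Real.sqrt_sq (norm_nonneg _)] at h1
      convert h1 using 1
      field_simp

/-- The reference ω is only Lipschitz, so it is never differentiated: near s it is frozen at ω s,
where the inner product hypothesis controls ‖ζ - ω s‖, and the drift of ω adds at most ρ to the
slope. Grönwall with the negative constant -c then applies to the resulting right-derivative
inequality. Taking ω = 0 and ρ = 0 gives contraction. -/
theorem tracking_bound {ζ ζ' ω : ℝ → E} {t₀ c ρ : ℝ} (hc : 0 < c)
    (hζ : ∀ t ∈ Set.Ici t₀, HasDerivWithinAt ζ (ζ' t) (Set.Ici t₀) t)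
    (hω : ∀ s ∈ Set.Ici t₀, ∀ t ∈ Set.Ici t₀, ‖ω t - ω s‖ ≤ ρ * |t - s|)
    (hinner : ∀ t ∈ Set.Ici t₀, inner ℝ (ζ' t) (ζ t - ω t) ≤ -c * ‖ζ t - ω t‖ ^ 2)
    (hzero : ∀ t ∈ Set.Ici t₀, ζ t - ω t = 0 → ζ' t = 0) {t : ℝ} (ht : t₀ ≤ t) :
    ‖ζ t - ω t‖ ≤ (‖ζ t₀ - ω t₀‖ - ρ / c) * Real.exp (-c * (t - t₀)) + ρ / c := by
  have hρ : 0 ≤ ρ := by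
    have := (norm_nonneg _).trans (hω t₀ (by simp) (t₀ + 1) (by simp))
    simpa using this
  have hωc : ContinuousOn ω (Set.Ici t₀) := by
    have : LipschitzOnWith ⟨ρ, hρ⟩ ω (Set.Ici t₀) := LipschitzOnWith.of_dist_le_mul
      fun x hx y hy => by
        rw [dist_eq_norm, Real.dist_eq]
        exact hω y hy x hx
    exact this.continuousOn
  have hcont : ContinuousOn (fun s => ‖ζ s - ω s‖) (Set.Icc t₀ t) :=
    ((HasDerivWithinAt.continuousOn hζ).sub hωc).norm.mono Set.Icc_subset_Ici_self
  have key := le_gronwallBound_of_liminf_deriv_right_le (f := fun s => ‖ζ s - ω s‖)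
    (f' := fun s => -c * ‖ζ s - ω s‖ + ρ) (δ := ‖ζ t₀ - ω t₀‖) (K := -c) (ε := ρ) hcont ?_ le_rfl
    (fun _ _ => le_rfl) t ⟨ht, le_rfl⟩
  · rw [gronwallBound_of_K_ne_0 (by linarith : -c ≠ 0)] at key
    refine key.trans (le_of_eq ?_)
    field_simp
    ring
  · intro s hs r hr
    have hsI : s ∈ Set.Ici t₀ := hs.1
    obtain ⟨g', hg', hder⟩ := hasDerivWithinAt_norm_of_inner_le (c := c)
      (δ := fun q => ζ q - ω s) ((hζ s hsI).sub_const (ω s)) (hinner s hsI) (hzero s hsI)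
    have hsub : Set.Ioi s ⊆ Set.Ici t₀ := fun q hq => hs.1.trans (le_of_lt hq)
    have hev := (hder.mono hsub).limsup_slope_le' (by simp) (r := r - ρ) (by linarith)
    refine Filter.Eventually.frequently ?_
    filter_upwards [hev, self_mem_nhdsWithin] with q hq hqs
    have hqs' : 0 < q - s := sub_pos.mpr hqs
    have h1 : ‖ζ q - ω q‖ ≤ ‖ζ q - ω s‖ + ρ * (q - s) := by
      have h2 := hω s hsI q (hsub hqs)
      rw [abs_of_pos hqs'] at h2
      have h3 : ζ q - ω q = (ζ q - ω s) - (ω q - ω s) := by abel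
      rw [h3]
      exact (norm_sub_le _ _).trans (by linarith)
    rw [slope_def_field, div_lt_iff₀ hqs'] at hq
    rw [inv_mul_lt_iff₀ hqs']
    nlinarith

end Tracking

/-! ### Monotone and cocoercive gradients -/

section Gradient

variable {E : Type*} [NormedAddCommGroup E] [InnerProductSpace ℝ E] [CompleteSpace E]

theorem hasDerivAt_comp_line {φ : E → ℝ} (hφ : Differentiable ℝ φ) (x d : E) (s : ℝ) :
    HasDerivAt (fun r : ℝ => φ (x + r • d)) (inner ℝ (gradient φ (x + s • d)) d) s := by
  have h1 := (hφ (x + s • d)).hasFDerivAt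
  have h2 : HasDerivAt (fun r : ℝ => x + r • d) d s := by
    simpa using ((hasDerivAt_id s).smul_const d).const_add x
  rw [inner_gradient_left]
  exact h1.comp_hasDerivAt s h2

/-- First order condition for convexity. -/
theorem add_inner_gradient_le {φ : E → ℝ} (hφ : Differentiable ℝ φ)
    (hmono : ∀ x y, 0 ≤ inner ℝ (gradient φ x - gradient φ y) (x - y)) (x y : E) :
    φ x + inner ℝ (gradient φ x) (y - x) ≤ φ y := by
  have hder := fun s => (hasDerivAt_comp_line hφ x (y - x) s).sub
    ((hasDerivAt_id s).mul_const (inner ℝ (gradient φ x) (y - x)))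
  have hm := monotoneOn_of_deriv_nonneg (convex_Icc (0 : ℝ) 1)
    (fun s _ => (hder s).continuousAt.continuousWithinAt)
    (fun s _ => (hder s).differentiableAt.differentiableWithinAt) (fun s hs => by
      rw [(hder s).deriv, one_mul, ← inner_sub_left]
      rw [interior_Icc] at hs
      have h := hmono (x + s • (y - x)) x
      rw [add_sub_cancel_left, inner_smul_right] at h
      exact nonneg_of_mul_nonneg_right h hs.1)
  have h := hm (Set.left_mem_Icc.mpr zero_le_one) (Set.right_mem_Icc.mpr zero_le_one) zero_le_one
  simp [-inner_gradient_left] at h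
  linarith

/-- The descent lemma. -/
theorem le_add_inner_gradient_add {φ : E → ℝ} (hφ : Differentiable ℝ φ) {M : ℝ}
    (hlip : ∀ x y, ‖gradient φ x - gradient φ y‖ ≤ M * ‖x - y‖) (x d : E) :
    φ (x + d) ≤ φ x + inner ℝ (gradient φ x) d + M / 2 * ‖d‖ ^ 2 := by
  have hder := fun s : ℝ => (((hasDerivAt_id s).mul_const (inner ℝ (gradient φ x) d)).add
    (((hasDerivAt_id s).pow 2).mul_const (M / 2 * ‖d‖ ^ 2))).sub (hasDerivAt_comp_line hφ x d s)
  have hm := monotoneOn_of_deriv_nonneg (convex_Icc (0 : ℝ) 1)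
    (fun s _ => (hder s).continuousAt.continuousWithinAt)
    (fun s _ => (hder s).differentiableAt.differentiableWithinAt) (fun s hs => by
      rw [(hder s).deriv]
      rw [interior_Icc] at hs
      have h1 := hlip (x + s • d) x
      rw [add_sub_cancel_left, norm_smul, Real.norm_of_nonneg hs.1.le] at h1
      have h2 := real_inner_le_norm (gradient φ (x + s • d) - gradient φ x) d
      rw [inner_sub_left] at h2
      have h3 := mul_le_mul_of_nonneg_right h1 (norm_nonneg d)
      simp [-inner_gradient_left]
      nlinarith)
  have h := hm (Set.left_mem_Icc.mpr zero_le_one) (Set.right_mem_Icc.mpr zero_le_one) zero_le_one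
  simp [-inner_gradient_left] at h
  linarith

/-- The Baillon–Haddad inequality: a monotone `M`-Lipschitz gradient is cocoercive. -/
theorem norm_sq_gradient_sub_le {φ : E → ℝ} (hφ : Differentiable ℝ φ) {M : ℝ} (hM : 0 < M)
    (hmono : ∀ x y, 0 ≤ inner ℝ (gradient φ x - gradient φ y) (x - y))
    (hlip : ∀ x y, ‖gradient φ x - gradient φ y‖ ≤ M * ‖x - y‖) (x y : E) :
    ‖gradient φ x - gradient φ y‖ ^ 2 ≤ M * inner ℝ (gradient φ x - gradient φ y) (x - y) := by
  -- Evaluate φ at x - h/M, a gradient step at x for φ minus its tangent at y: the tangent at y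
  -- bounds the value from below, the descent lemma at x from above. Adding the two instances with x
  -- and y exchanged gives cocoercivity.
  have half : ∀ x y, φ y + inner ℝ (gradient φ y) (x - y)
      + 1 / (2 * M) * ‖gradient φ x - gradient φ y‖ ^ 2 ≤ φ x := by
    intro x y
    set h := gradient φ x - gradient φ y with hh
    have h1 := add_inner_gradient_le hφ hmono y (x + (-(1 / M)) • h)
    have h2 := le_add_inner_gradient_add hφ hlip x ((-(1 / M)) • h)
    have h3 : x + (-(1 / M)) • h - y = (x - y) + (-(1 / M)) • h := by abel
    rw [h3, inner_add_right, inner_smul_right] at h1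
    rw [inner_smul_right, norm_smul, mul_pow, Real.norm_eq_abs, sq_abs] at h2
    have h4 : inner ℝ (gradient φ x) h - inner ℝ (gradient φ y) h = ‖h‖ ^ 2 := by
      rw [← inner_sub_left, ← hh, real_inner_self_eq_norm_sq]
    have h5 : M / 2 * ((-(1 / M)) ^ 2 * ‖h‖ ^ 2) = 1 / (2 * M) * ‖h‖ ^ 2 := by
      field_simp
    have h6 : 1 / M * ‖h‖ ^ 2 = 2 * (1 / (2 * M) * ‖h‖ ^ 2) := by field_simp
    rw [h5] at h2
    have h7 := congrArg (1 / M * ·) h4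
    simp only [mul_sub] at h7
    linarith
  have h1 := half x y
  have h2 := half y x
  rw [norm_sub_rev (gradient φ y), ← neg_sub x y, inner_neg_right] at h2
  have h3 : 1 / M * ‖gradient φ x - gradient φ y‖ ^ 2
      ≤ inner ℝ (gradient φ x - gradient φ y) (x - y) := by
    rw [inner_sub_left]
    have : 1 / M = 1 / (2 * M) + 1 / (2 * M) := by field_simp; norm_num
    rw [this, add_mul]
    linarith
  rwa [one_div, inv_mul_le_iff₀ hM] at h3

/-- A strongly monotone Lipschitz map has a zero. -/
theorem exists_zero_of_stronglyMonotone {g : E → E} {m M : ℝ} (hm : 0 < m)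
    (hmono : ∀ x y, m * ‖x - y‖ ^ 2 ≤ inner ℝ (g x - g y) (x - y))
    (hlip : ∀ x y, ‖g x - g y‖ ≤ M * ‖x - y‖) : ∃ x, g x = 0 := by
  set M' := max m M with hM'
  have hM'0 : 0 < M' := lt_max_of_lt_left hm
  -- The map x ↦ x - ηg(x) has squared Lipschitz constant at most 1 - 2ηm + η²M'², and this choice
  -- of η makes it 1 - ηm. The maximum in M' ensures ηm ≤ 1.
  set η := m / M' ^ 2 with hη
  have hη0 : 0 < η := by positivity
  have hq : η * m ≤ 1 := by
    rw [hη, div_mul_eq_mul_div, div_le_one (by positivity), ← sq]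
    gcongr
    exact le_max_left _ _
  set k := Real.sqrt (1 - η * m) with hk
  have hk1 : k < 1 := by
    rw [hk, Real.sqrt_lt' one_pos]
    have : 0 < η * m := by positivity
    linarith
  have hk' : (k.toNNReal : ℝ) = k := Real.coe_toNNReal _ (Real.sqrt_nonneg _)
  have hcontr : ContractingWith k.toNNReal (fun x => x - η • g x) := by
    refine ⟨by simpa using hk1, LipschitzWith.of_dist_le_mul fun x y => ?_⟩
    rw [dist_eq_norm, dist_eq_norm]
    refine abs_le_of_sq_le_sq' ?_ (by positivity) |>.2
    have h1 : x - η • g x - (y - η • g y) = (x - y) - η • (g x - g y) := by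
      rw [smul_sub]; abel
    rw [h1, norm_sub_sq_real, inner_smul_right, real_inner_comm, norm_smul, mul_pow, mul_pow,
      Real.norm_of_nonneg hη0.le]
    rw [hk', hk, Real.sq_sqrt (by linarith)]
    have h2 := hmono x y
    have h3 : ‖g x - g y‖ ^ 2 ≤ M' ^ 2 * ‖x - y‖ ^ 2 := by
      rw [← mul_pow]
      exact pow_le_pow_left₀ (norm_nonneg _) ((hlip x y).trans (by gcongr; exact le_max_right _ _)) 2
    have h4 : η ^ 2 * ‖g x - g y‖ ^ 2 ≤ η * m * ‖x - y‖ ^ 2 := by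
      calc η ^ 2 * ‖g x - g y‖ ^ 2 ≤ η ^ 2 * (M' ^ 2 * ‖x - y‖ ^ 2) := by gcongr
        _ = η * m * ‖x - y‖ ^ 2 := by rw [hη]; field_simp
    nlinarith
  have hfix := hcontr.fixedPoint_isFixedPt
  have h0 : η • g hcontr.fixedPoint = 0 := by
    have : hcontr.fixedPoint - η • g hcontr.fixedPoint = hcontr.fixedPoint := hfix
    simpa using this
  exact ⟨_, (smul_eq_zero.mp h0).resolve_left hη0.ne'⟩

end Gradient

/-! ### The Laplacian spectrum -/

section Spectrum

open Matrix

variable {N : ℕ} {G : SimpleGraph (Fin N)} [DecidableRel G.Adj] {T : Matrix (Fin N) (Fin N) ℝ}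

theorem lapEigenvalue_monotone (G : SimpleGraph (Fin N)) [DecidableRel G.Adj] :
    Monotone (lapEigenvalue G) := fun i j hij =>
  (SimpleGraph.isHermitian_lapMatrix (R := ℝ) G).eigenvalues₀_antitone
    (by simpa [Fin.le_def] using Fin.rev_le_rev.mpr hij)

theorem Diagonalizes.mul_transpose (hT : Diagonalizes G T) : T * Tᵀ = 1 :=
  (Matrix.mem_orthogonalGroup_iff _ _).mp hT.1

theorem Diagonalizes.transpose_mul (hT : Diagonalizes G T) : Tᵀ * T = 1 :=
  (Matrix.mem_orthogonalGroup_iff' _ _).mp hT.1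

theorem Diagonalizes.mul_lapMatrix (hT : Diagonalizes G T) :
    T * G.lapMatrix ℝ = diagonal (lapEigenvalue G) * T := by
  rw [← hT.2, Matrix.mul_assoc _ Tᵀ, hT.transpose_mul, Matrix.mul_one]

theorem Diagonalizes.lapMatrix_mulVec_row (hT : Diagonalizes G T) (k : Fin N) :
    G.lapMatrix ℝ *ᵥ T k = lapEigenvalue G k • T k := by
  have h := congrFun hT.mul_lapMatrix k
  rw [← (G.isSymm_lapMatrix (R := ℝ)).eq, mulVec_transpose]
  ext j
  have := congrFun h j
  rwa [diagonal_mul] at this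

theorem Diagonalizes.row_dotProduct_row (hT : Diagonalizes G T) (k l : Fin N) :
    T k ⬝ᵥ T l = if k = l then 1 else 0 := by
  have := congrFun (congrFun hT.mul_transpose k) l
  rwa [Matrix.one_apply] at this

theorem Diagonalizes.lapEigenvalue_nonneg (hT : Diagonalizes G T) (k : Fin N) :
    0 ≤ lapEigenvalue G k := by
  have h := (posSemidef_iff_dotProduct_mulVec.mp (SimpleGraph.posSemidef_lapMatrix ℝ G)).2 (T k)
  rw [star_trivial, hT.lapMatrix_mulVec_row, dotProduct_smul, hT.row_dotProduct_row] at h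
  simpa using h

theorem eq_const_of_lapMatrix_mulVec_eq_zero (hG : G.Connected) {v : Fin N → ℝ}
    (hv : G.lapMatrix ℝ *ᵥ v = 0) (i j : Fin N) : v i = v j :=
  (SimpleGraph.lapMatrix_mulVec_eq_zero_iff_forall_reachable G).mp hv i j (hG.preconnected i j)

/-- Since L𝟏 = 0, the nonzero vector T𝟏 is killed by diag(λ), so some eigenvalue vanishes; by order
and nonnegativity so does the first. -/
theorem Diagonalizes.lapEigenvalue_zero (hN : 2 ≤ N) (hT : Diagonalizes G T) :
    lapEigenvalue G ⟨0, by omega⟩ = 0 := by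
  have h0 : T *ᵥ (G.lapMatrix ℝ *ᵥ fun _ => 1) = 0 := by
    rw [G.lapMatrix_mulVec_const_eq_zero, mulVec_zero]
  rw [mulVec_mulVec, hT.mul_lapMatrix, ← mulVec_mulVec] at h0
  have hne : T *ᵥ (fun _ => (1 : ℝ)) ≠ 0 := by
    intro h
    have h1 := congrArg (Tᵀ *ᵥ ·) h
    simp only [mulVec_mulVec, hT.transpose_mul, one_mulVec, mulVec_zero] at h1
    exact one_ne_zero (congrFun h1 ⟨0, by omega⟩)
  obtain ⟨k, hk⟩ := Function.ne_iff.mp hne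
  have h2 := congrFun h0 k
  rw [mulVec_diagonal] at h2
  have h3 : lapEigenvalue G k = 0 := (mul_eq_zero.mp h2).resolve_right hk
  exact le_antisymm (h3 ▸ lapEigenvalue_monotone G (Fin.mk_le_of_le_val (Nat.zero_le _)))
    (hT.lapEigenvalue_nonneg _)

theorem Diagonalizes.lapMatrix_mulVec_first_row (hN : 2 ≤ N) (hT : Diagonalizes G T) :
    G.lapMatrix ℝ *ᵥ T ⟨0, by omega⟩ = 0 := by
  rw [hT.lapMatrix_mulVec_row, hT.lapEigenvalue_zero hN, zero_smul]

/-- If λ₂ = 0, the first two rows of `T` both lie in the kernel of L, hence are constant by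
connectedness, and two constant vectors cannot be orthonormal. -/
theorem Diagonalizes.lambdaTwo_pos (hN : 2 ≤ N) (hG : G.Connected) (hT : Diagonalizes G T) :
    0 < lambdaTwo hN G := by
  refine (hT.lapEigenvalue_nonneg _).lt_of_ne' fun h => ?_
  have h1 : G.lapMatrix ℝ *ᵥ T ⟨1, by omega⟩ = 0 := by
    rw [hT.lapMatrix_mulVec_row]
    exact (congrArg (· • _) h).trans (zero_smul _ _)
  have c0 := eq_const_of_lapMatrix_mulVec_eq_zero hG (hT.lapMatrix_mulVec_first_row hN)
  have c1 := eq_const_of_lapMatrix_mulVec_eq_zero hG h1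
  have d00 := hT.row_dotProduct_row ⟨0, by omega⟩ ⟨0, by omega⟩
  have d11 := hT.row_dotProduct_row ⟨1, by omega⟩ ⟨1, by omega⟩
  have d01 := hT.row_dotProduct_row ⟨0, by omega⟩ ⟨1, by omega⟩
  simp only [dotProduct, c0 _ ⟨0, by omega⟩, c1 _ ⟨0, by omega⟩] at d00 d11 d01
  simp at d00 d11 d01
  rcases d01 with h | h | h
  · omega
  · simp [h] at d00
  · simp [h] at d11

theorem lambdaTwo_le (hN : 2 ≤ N) (k : Fin (N - 1)) :
    lambdaTwo hN G ≤ lapEigenvalue G (tailIdx k) :=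
  lapEigenvalue_monotone G (by simp [tailIdx, Fin.le_def])

theorem le_lambdaN (hN : 2 ≤ N) (k : Fin N) : lapEigenvalue G k ≤ lambdaN hN G :=
  lapEigenvalue_monotone G (by simp only [Fin.le_def]; omega)

theorem mulVec_dotProduct_mulVec_of_transpose_mul {ι κ : Type*} [Fintype ι] [Fintype κ]
    [DecidableEq κ] {A : Matrix ι κ ℝ} (hA : Aᵀ * A = 1) (v w : κ → ℝ) :
    (A *ᵥ v) ⬝ᵥ (A *ᵥ w) = v ⬝ᵥ w := by
  rw [dotProduct_mulVec, ← mulVec_transpose, mulVec_mulVec, hA, one_mulVec]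

theorem Diagonalizes.dotProduct_lapMatrix_mulVec_le (hN : 2 ≤ N) (hT : Diagonalizes G T)
    (v : Fin N → ℝ) : v ⬝ᵥ G.lapMatrix ℝ *ᵥ v ≤ lambdaN hN G * (v ⬝ᵥ v) := by
  have h1 : v ⬝ᵥ G.lapMatrix ℝ *ᵥ v = (T *ᵥ v) ⬝ᵥ diagonal (lapEigenvalue G) *ᵥ (T *ᵥ v) := by
    rw [mulVec_mulVec, ← hT.mul_lapMatrix, ← mulVec_mulVec,
      mulVec_dotProduct_mulVec_of_transpose_mul hT.transpose_mul]
  rw [h1, ← mulVec_dotProduct_mulVec_of_transpose_mul hT.transpose_mul v v, dotProduct, dotProduct, Finset.mul_sum]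
  refine Finset.sum_le_sum fun k _ => ?_
  rw [mulVec_diagonal]
  nlinarith [le_lambdaN (G := G) hN k, mul_self_nonneg ((T *ᵥ v) k)]

/-- The Rayleigh quotient at a basis vector is a vertex degree, which is at least 1 in a connected
graph with two or more vertices. -/
theorem Diagonalizes.one_le_lambdaN (hN : 2 ≤ N) (hG : G.Connected) (hT : Diagonalizes G T) :
    1 ≤ lambdaN hN G := by
  have : Nontrivial (Fin N) := Fin.nontrivial_iff_two_le.mpr hN
  have h := hT.dotProduct_lapMatrix_mulVec_le hN (Pi.single ⟨0, by omega⟩ 1)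
  have hd := hG.preconnected.degree_pos_of_nontrivial (⟨0, by omega⟩ : Fin N)
  have hd' : (1 : ℝ) ≤ G.degree ⟨0, by omega⟩ := by exact_mod_cast hd
  simp [SimpleGraph.lapMatrix, SimpleGraph.degMatrix] at h
  linarith

theorem sum_univ_eq_add_sum_tailIdx {M : Type*} [AddCommMonoid M] (hN : 2 ≤ N) (h : Fin N → M) :
    ∑ k, h k = h ⟨0, by omega⟩ + ∑ k : Fin (N - 1), h (tailIdx k) := by
  obtain ⟨K, rfl⟩ : ∃ K, N = K + 1 := ⟨N - 1, by omega⟩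
  exact Fin.sum_univ_succ h

theorem tailIdx_injective : Function.Injective (tailIdx : Fin (N - 1) → Fin N) := fun i j h => by
  simpa [tailIdx, Fin.ext_iff] using h

theorem Diagonalizes.dropFirstRow_mul_transpose (hT : Diagonalizes G T) :
    dropFirstRow T * (dropFirstRow T)ᵀ = 1 := by
  ext i j
  have := hT.row_dotProduct_row (tailIdx i) (tailIdx j)
  simp only [tailIdx_injective.eq_iff] at this
  rw [Matrix.one_apply, ← this]
  rfl

theorem Diagonalizes.dropFirstRow_mul_lapMatrix (hT : Diagonalizes G T) :
    dropFirstRow T * G.lapMatrix ℝ = Lam G * dropFirstRow T := by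
  ext i j
  have := congrFun (congrFun hT.mul_lapMatrix (tailIdx i)) j
  rw [diagonal_mul] at this
  rw [Lam, diagonal_mul]
  exact this

theorem Diagonalizes.dropFirstRow_transpose_mul (hN : 2 ≤ N) (hT : Diagonalizes G T) :
    (dropFirstRow T)ᵀ * dropFirstRow T =
      1 - vecMulVec (T ⟨0, by omega⟩) (T ⟨0, by omega⟩) := by
  rw [eq_sub_iff_add_eq', ← hT.transpose_mul]
  ext i j
  simp only [Matrix.add_apply, Matrix.mul_apply, vecMulVec_apply, transpose_apply]
  rw [sum_univ_eq_add_sum_tailIdx hN]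
  rfl

/-- RᵀR differs from the identity by the projection onto the first row, which L annihilates. Hence
the projection by R is invisible to the dynamics. -/
theorem Diagonalizes.lapMatrix_mul_transpose_mul (hN : 2 ≤ N) (hT : Diagonalizes G T) :
    G.lapMatrix ℝ * ((dropFirstRow T)ᵀ * dropFirstRow T) = G.lapMatrix ℝ := by
  rw [hT.dropFirstRow_transpose_mul hN, Matrix.mul_sub, Matrix.mul_one, mul_vecMulVec,
    hT.lapMatrix_mulVec_first_row hN, zero_vecMulVec, sub_zero]

/-- The range of the Laplacian of a connected graph consists of the vectors with zero sum. -/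
theorem Diagonalizes.exists_lapMatrix_mulVec_eq (hN : 2 ≤ N) (hG : G.Connected)
    (hT : Diagonalizes G T) {g : Fin N → ℝ} (hg : ∑ i, g i = 0) :
    ∃ v, G.lapMatrix ℝ *ᵥ v = g := by
  set R := dropFirstRow T with hR
  have hpos : ∀ k : Fin (N - 1), lapEigenvalue G (tailIdx k) ≠ 0 := fun k =>
    ((hT.lambdaTwo_pos hN hG).trans_le (lambdaTwo_le hN k)).ne'
  have hLR : G.lapMatrix ℝ * Rᵀ = Rᵀ * Lam G := by
    have h := congrArg transpose hT.dropFirstRow_mul_lapMatrix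
    rwa [Matrix.transpose_mul, Matrix.transpose_mul, (G.isSymm_lapMatrix (R := ℝ)).eq, Lam,
      diagonal_transpose] at h
  -- The witness is the pseudo-inverse RᵀΛ⁻¹R of L. Multiplying by L leaves RᵀR = 1 - (projection
  -- onto the constant first row), and that projection kills `g`.
  refine ⟨(Rᵀ * diagonal (fun k => (lapEigenvalue G (tailIdx k))⁻¹) * R) *ᵥ g, ?_⟩
  have hLam : Lam G * diagonal (fun k => (lapEigenvalue G (tailIdx k))⁻¹) = 1 := by
    rw [Lam, diagonal_mul_diagonal, ← diagonal_one]
    congr 1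
    ext k
    exact mul_inv_cancel₀ (hpos k)
  rw [mulVec_mulVec, ← Matrix.mul_assoc, ← Matrix.mul_assoc, hLR, Matrix.mul_assoc _ (Lam G),
    hLam, Matrix.mul_one, hT.dropFirstRow_transpose_mul hN, sub_mulVec, one_mulVec,
    vecMulVec_mulVec]
  have c0 := eq_const_of_lapMatrix_mulVec_eq_zero hG (hT.lapMatrix_mulVec_first_row hN)
  have : T ⟨0, by omega⟩ ⬝ᵥ g = 0 := by
    simp only [dotProduct, c0 _ ⟨0, by omega⟩]
    rw [← Finset.mul_sum, hg, mul_zero]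
  simp [this]

end Spectrum

/-! ### Weighted norms as Euclidean norms -/

section WeightedNorm

open Matrix

variable {ι : Type*} [Fintype ι] [DecidableEq ι]

/-- The vector `P^{1/2} v` whose Euclidean norm is the weighted norm of `v`. -/
def sqrtMap (P : Matrix ι ι ℝ) : (ι → ℝ) →L[ℝ] EuclideanSpace ℝ ι :=
  LinearMap.toContinuousLinearMap
    ((WithLp.linearEquiv 2 ℝ (ι → ℝ)).symm.toLinearMap ∘ₗ (CFC.sqrt P).mulVecLin)

theorem sqrtMap_apply (P : Matrix ι ι ℝ) (v : ι → ℝ) :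
    sqrtMap P v = WithLp.toLp 2 (CFC.sqrt P *ᵥ v) := rfl

theorem norm_sqrtMap (P : Matrix ι ι ℝ) (v : ι → ℝ) : ‖sqrtMap P v‖ = sqrtNorm P v := rfl

theorem inner_sqrtMap {P : Matrix ι ι ℝ} (hP : P.PosSemidef) (v w : ι → ℝ) :
    inner ℝ (sqrtMap P v) (sqrtMap P w) = w ⬝ᵥ P *ᵥ v := by
  have hs : (CFC.sqrt P).IsHermitian := (Matrix.nonneg_iff_posSemidef.mp (CFC.sqrt_nonneg P)).1
  have hs' : (CFC.sqrt P)ᵀ = CFC.sqrt P := by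
    rw [← conjTranspose_eq_transpose_of_trivial]; exact hs
  have hmul : CFC.sqrt P * CFC.sqrt P = P := CFC.sqrt_mul_sqrt_self P hP.nonneg
  rw [sqrtMap_apply, sqrtMap_apply, EuclideanSpace.inner_eq_star_dotProduct, star_trivial]
  simp only
  nth_rw 3 [← hmul]
  rw [← mulVec_mulVec, dotProduct_mulVec w, ← mulVec_transpose, hs']

theorem sqrtNorm_sq {P : Matrix ι ι ℝ} (hP : P.PosSemidef) (v : ι → ℝ) :
    sqrtNorm P v ^ 2 = v ⬝ᵥ P *ᵥ v := by
  rw [← norm_sqrtMap, ← real_inner_self_eq_norm_sq, inner_sqrtMap hP]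

theorem sqrtMap_eq_zero_iff {P : Matrix ι ι ℝ} (hP : P.PosDef) {v : ι → ℝ} :
    sqrtMap P v = 0 ↔ v = 0 := by
  refine ⟨fun h => ?_, fun h => by rw [h, map_zero]⟩
  by_contra hv
  have h1 := hP.dotProduct_mulVec_pos hv
  rw [star_trivial, ← inner_sqrtMap hP.posSemidef, h, inner_zero_left] at h1
  exact h1.false

theorem dotProduct_mulVec_le_lambdaMax {P : Matrix ι ι ℝ} (hP : P.IsHermitian) (v : ι → ℝ) :
    v ⬝ᵥ P *ᵥ v ≤ lambdaMax P * (v ⬝ᵥ v) := by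
  have hbdd : BddAbove (spectrum ℝ P) := by
    rw [hP.spectrum_real_eq_range_eigenvalues]
    exact (Set.finite_range _).bddAbove
  have h : P ≤ algebraMap ℝ (Matrix ι ι ℝ) (lambdaMax P) :=
    le_algebraMap_of_spectrum_le (fun r hr => le_csSup hbdd hr) hP
  have h1 := (posSemidef_iff_dotProduct_mulVec.mp (Matrix.le_iff.mp h)).2 v
  rw [star_trivial, sub_mulVec, dotProduct_sub, Algebra.algebraMap_eq_smul_one, smul_mulVec,
    one_mulVec, dotProduct_smul, smul_eq_mul] at h1
  linarith

theorem sq_dotProduct_le {κ : Type*} [Fintype κ] (v w : κ → ℝ) :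
    (v ⬝ᵥ w) ^ 2 ≤ (v ⬝ᵥ v) * (w ⬝ᵥ w) := by
  simpa [dotProduct, sq] using Finset.sum_mul_sq_le_sq_mul_sq Finset.univ v w

theorem dotProduct_self_nonneg' {κ : Type*} [Fintype κ] (v : κ → ℝ) : 0 ≤ v ⬝ᵥ v :=
  Finset.sum_nonneg fun i _ => mul_self_nonneg (v i)

end WeightedNorm

/-! ### The matrix `Ā*` -/

section Abar

open Matrix

variable {N : ℕ} {G : SimpleGraph (Fin N)} [DecidableRel G.Adj] {T : Matrix (Fin N) (Fin N) ℝ}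

/-- `R ⊗ Iₙ`. -/
def rowKron {N : ℕ} (n : ℕ) (T : Matrix (Fin N) (Fin N) ℝ) :
    Matrix (Fin (N - 1) × Fin n) (Fin N × Fin n) ℝ :=
  dropFirstRow T ⊗ₖ (1 : Matrix (Fin n) (Fin n) ℝ)

theorem rowKron_transpose (n : ℕ) (T : Matrix (Fin N) (Fin N) ℝ) :
    (rowKron n T)ᵀ = (dropFirstRow T)ᵀ ⊗ₖ (1 : Matrix (Fin n) (Fin n) ℝ) := by
  rw [rowKron, ← kroneckerMap_transpose, transpose_one]

theorem lapKron_transpose (n : ℕ) (G : SimpleGraph (Fin N)) [DecidableRel G.Adj] :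
    (lapKron n G)ᵀ = lapKron n G := by
  rw [lapKron, ← kroneckerMap_transpose, transpose_one, (G.isSymm_lapMatrix (R := ℝ)).eq]

theorem Diagonalizes.rowKron_mul_lapKron (n : ℕ) (hT : Diagonalizes G T) :
    rowKron n T * lapKron n G = Abar n G T := by
  rw [rowKron, lapKron, ← mul_kronecker_mul, hT.dropFirstRow_mul_lapMatrix, Matrix.mul_one]
  rfl

theorem Diagonalizes.lapKron_mul_transpose (n : ℕ) (hT : Diagonalizes G T) :
    lapKron n G * (rowKron n T)ᵀ = (Abar n G T)ᵀ := by
  rw [← hT.rowKron_mul_lapKron, Matrix.transpose_mul, lapKron_transpose]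

theorem Diagonalizes.rowKron_mul_transpose (n : ℕ) (hT : Diagonalizes G T) :
    rowKron n T * (rowKron n T)ᵀ = 1 := by
  rw [rowKron_transpose, rowKron, ← mul_kronecker_mul, hT.dropFirstRow_mul_transpose,
    Matrix.mul_one, one_kronecker_one]

theorem Diagonalizes.transpose_Abar_mul_rowKron (n : ℕ) (hN : 2 ≤ N) (hT : Diagonalizes G T) :
    (Abar n G T)ᵀ * rowKron n T = lapKron n G := by
  rw [← hT.lapKron_mul_transpose, Matrix.mul_assoc, rowKron_transpose, rowKron, lapKron,
    ← mul_kronecker_mul, ← mul_kronecker_mul, hT.lapMatrix_mul_transpose_mul hN, Matrix.mul_one,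
    Matrix.mul_one]

theorem Abar_eq_diagonal_mul (n : ℕ) (G : SimpleGraph (Fin N)) [DecidableRel G.Adj]
    (T : Matrix (Fin N) (Fin N) ℝ) :
    Abar n G T = diagonal (fun p : Fin (N - 1) × Fin n => lapEigenvalue G (tailIdx p.1)) *
      rowKron n T := by
  have : diagonal (fun p : Fin (N - 1) × Fin n => lapEigenvalue G (tailIdx p.1)) =
      Lam G ⊗ₖ (1 : Matrix (Fin n) (Fin n) ℝ) := by
    rw [Lam, ← diagonal_one, diagonal_kronecker_diagonal]
    simp
  rw [this, rowKron, ← mul_kronecker_mul, Matrix.mul_one]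
  rfl

/-- With y = (R ⊗ I)x, the transpose is an isometry, so ‖y‖² = ⟨(R ⊗ I)ᵀy, x⟩ ≤ ‖y‖‖x‖. -/
theorem Diagonalizes.rowKron_contraction {n : ℕ} (hT : Diagonalizes G T)
    (x : Fin N × Fin n → ℝ) : (rowKron n T *ᵥ x) ⬝ᵥ (rowKron n T *ᵥ x) ≤ x ⬝ᵥ x := by
  set y := rowKron n T *ᵥ x with hy
  have h1 : ((rowKron n T)ᵀ *ᵥ y) ⬝ᵥ x = y ⬝ᵥ y := by
    rw [mulVec_transpose, ← dotProduct_mulVec]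
  have h2 : ((rowKron n T)ᵀ *ᵥ y) ⬝ᵥ ((rowKron n T)ᵀ *ᵥ y) = y ⬝ᵥ y :=
    mulVec_dotProduct_mulVec_of_transpose_mul
      (by rw [transpose_transpose, hT.rowKron_mul_transpose]) y y
  have h3 := sq_dotProduct_le ((rowKron n T)ᵀ *ᵥ y) x
  rw [h1, h2] at h3
  have h4 := dotProduct_self_nonneg' y
  by_contra! h
  nlinarith [dotProduct_self_nonneg' x]

theorem Diagonalizes.Abar_mulVec_le {n : ℕ} (hN : 2 ≤ N) (hT : Diagonalizes G T)
    (x : Fin N × Fin n → ℝ) :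
    (Abar n G T *ᵥ x) ⬝ᵥ (Abar n G T *ᵥ x) ≤ lambdaN hN G ^ 2 * (x ⬝ᵥ x) := by
  refine le_trans ?_ (mul_le_mul_of_nonneg_left (hT.rowKron_contraction x) (sq_nonneg _))
  rw [Abar_eq_diagonal_mul, ← mulVec_mulVec, dotProduct, dotProduct, Finset.mul_sum]
  refine Finset.sum_le_sum fun p _ => ?_
  rw [mulVec_diagonal]
  have h1 := pow_le_pow_left₀ (hT.lapEigenvalue_nonneg (tailIdx p.1))
    (le_lambdaN (G := G) hN (tailIdx p.1)) 2
  nlinarith [mul_self_nonneg ((rowKron n T *ᵥ x) p)]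

/-- Āᵀ is Λ ⊗ I followed by the isometry (R ⊗ I)ᵀ, so the least entry λ₂ of Λ bounds it below. This
is the source of dissipation in the dual variable. -/
theorem Diagonalizes.le_transpose_Abar_mulVec {n : ℕ} (hN : 2 ≤ N) (hG : G.Connected)
    (hT : Diagonalizes G T) (y : Fin (N - 1) × Fin n → ℝ) :
    lambdaTwo hN G ^ 2 * (y ⬝ᵥ y) ≤ ((Abar n G T)ᵀ *ᵥ y) ⬝ᵥ ((Abar n G T)ᵀ *ᵥ y) := by
  rw [Abar_eq_diagonal_mul, Matrix.transpose_mul, diagonal_transpose, ← mulVec_mulVec,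
    mulVec_dotProduct_mulVec_of_transpose_mul
      (by rw [transpose_transpose, hT.rowKron_mul_transpose]), dotProduct, dotProduct,
    Finset.mul_sum]
  refine Finset.sum_le_sum fun p _ => ?_
  rw [mulVec_diagonal]
  have h1 := pow_le_pow_left₀ (hT.lambdaTwo_pos hN hG).le (lambdaTwo_le (G := G) hN p.1) 2
  nlinarith [mul_self_nonneg (y p)]

end Abar

/-! ### The weight `P̃` -/

section Ptilde

open Matrix

variable {n N : ℕ} {hN : 2 ≤ N} {G : SimpleGraph (Fin N)} [DecidableRel G.Adj]
  {T : Matrix (Fin N) (Fin N) ℝ} {linf lsup : Fin N → ℝ} {ε : ℝ}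

theorem Ptilde_isHermitian : (Ptilde n hN G T linf lsup ε).IsHermitian := by
  rw [IsHermitian, conjTranspose_eq_transpose_of_trivial, Ptilde, fromBlocks_transpose]
  simp

theorem dotProduct_Ptilde_mulVec (x x' : Fin N × Fin n → ℝ) (y y' : Fin (N - 1) × Fin n → ℝ) :
    Sum.elim x y ⬝ᵥ Ptilde n hN G T linf lsup ε *ᵥ Sum.elim x' y' =
      x ⬝ᵥ x' + y ⬝ᵥ y' + alphaTilde hN G linf lsup ε *
        (((Abar n G T)ᵀ *ᵥ y') ⬝ᵥ x + ((Abar n G T)ᵀ *ᵥ y) ⬝ᵥ x') := by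
  rw [Ptilde, fromBlocks_mulVec, sumElim_dotProduct_sumElim]
  simp only [Sum.elim_comp_inl, Sum.elim_comp_inr, one_mulVec, smul_mulVec, dotProduct_add,
    dotProduct_smul, smul_eq_mul]
  rw [dotProduct_mulVec y, ← mulVec_transpose, dotProduct_comm x ((Abar n G T)ᵀ *ᵥ y')]
  ring

theorem iInf_pos_of_forall_pos {ι : Type*} [Finite ι] [Nonempty ι] {v : ι → ℝ}
    (hv : ∀ i, 0 < v i) : 0 < ⨅ i, v i := by
  obtain ⟨i, hi⟩ := exists_eq_ciInf_of_finite (f := v)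
  rw [← hi]
  exact hv i

theorem alphaTilde_pos (hN : 2 ≤ N) (hG : G.Connected) (hT : Diagonalizes G T)
    (hlinf : ∀ i, 0 < linf i) (hε : 0 < ε) : 0 < alphaTilde hN G linf lsup ε := by
  have : Nonempty (Fin N) := ⟨⟨0, by omega⟩⟩
  have h1 : 0 < ⨅ i, linf i := iInf_pos_of_forall_pos hlinf
  have h2 := hT.one_le_lambdaN hN hG
  have h3 : 0 < lambdaN hN G := by linarith
  rw [alphaTilde]
  positivity

theorem rate_pos (hN : 2 ≤ N) (hG : G.Connected) (hT : Diagonalizes G T)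
    (hlinf : ∀ i, 0 < linf i) (hε : 0 < ε) : 0 < rate hN G linf lsup ε := by
  have h1 := alphaTilde_pos (lsup := lsup) hN hG hT hlinf hε
  have h2 := hT.one_le_lambdaN hN hG
  have h3 := hT.lambdaTwo_pos hN hG
  have h4 : 0 < lambdaN hN G := by linarith
  rw [rate]
  positivity

theorem alphaTilde_mul_eq (hN : 2 ≤ N) (hG : G.Connected) (hT : Diagonalizes G T) :
    alphaTilde hN G linf lsup ε * (lambdaN hN G ^ 2 +
      3 / 4 * lambdaN hN G * lambdaTwo hN G ^ 2 + ‖lsup‖ ^ 2) = ε * ⨅ i, linf i := by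
  have h2 := hT.one_le_lambdaN hN hG
  have h3 : 0 < lambdaN hN G := by linarith
  rw [alphaTilde, div_mul_cancel₀]
  positivity

theorem Ptilde_posDef (hN : 2 ≤ N) (hG : G.Connected) (hT : Diagonalizes G T)
    (hlinf : ∀ i, 0 < linf i) (hε : 0 < ε) (hε1 : ε < 1)
    (hle : 0 < n → ⨅ i, linf i ≤ ‖lsup‖) : (Ptilde n hN G T linf lsup ε).PosDef := by
  refine PosDef.of_dotProduct_mulVec_pos Ptilde_isHermitian fun z hz => ?_
  -- A nonzero vector needs a nonempty index type. For n = 0 strong convexity is vacuous and does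
  -- not force `linf` below `lsup`.
  have hn : 0 < n := by
    obtain ⟨i, -⟩ := Function.ne_iff.mp hz
    rcases i with i | i <;> exact i.2.pos
  rw [star_trivial, ← Sum.elim_comp_inl_inr z, dotProduct_Ptilde_mulVec]
  set x := z ∘ Sum.inl
  set y := z ∘ Sum.inr
  have hα := alphaTilde_pos (lsup := lsup) hN hG hT hlinf hε
  have hαD := alphaTilde_mul_eq (linf := linf) (lsup := lsup) (ε := ε) hN hG hT
  set α := alphaTilde hN G linf lsup ε
  set a := lambdaN hN G
  have ha : 1 ≤ a := hT.one_le_lambdaN hN hG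
  have hle := hle hn
  have : Nonempty (Fin N) := ⟨⟨0, by omega⟩⟩
  have hm : 0 < ⨅ i, linf i := iInf_pos_of_forall_pos hlinf
  set m := ⨅ i, linf i
  set M := ‖lsup‖
  have hM : 0 < M := hm.trans_le hle
  -- From α(a² + M²) ≤ εm ≤ M and 2aM ≤ a² + M². The off-diagonal term of the form is then at most
  -- half of the diagonal one.
  have hαa : 2 * (α * a) ≤ 1 := by
    have h1 : α * (a ^ 2 + M ^ 2) ≤ M := by
      have : 0 ≤ α * (3 / 4 * a * lambdaTwo hN G ^ 2) := by positivity
      nlinarith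
    have h2 : α * (2 * a * M) ≤ 1 * M := by
      nlinarith [mul_nonneg hα.le (sq_nonneg (a - M))]
    have h3 : α * (2 * a) ≤ 1 := le_of_mul_le_mul_right (by linarith) hM
    linarith
  have hX := dotProduct_self_nonneg' x
  have hY := dotProduct_self_nonneg' y
  have hXY : 0 < x ⬝ᵥ x + y ⬝ᵥ y := by
    rw [← sumElim_dotProduct_sumElim, Sum.elim_comp_inl_inr]
    exact lt_of_le_of_ne (dotProduct_self_nonneg' z) (Ne.symm (dotProduct_self_eq_zero.not.mpr hz))
  have hcs : (((Abar n G T)ᵀ *ᵥ y) ⬝ᵥ x) ^ 2 ≤ (y ⬝ᵥ y) * (a ^ 2 * (x ⬝ᵥ x)) := by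
    rw [mulVec_transpose, ← dotProduct_mulVec]
    exact (sq_dotProduct_le _ _).trans (mul_le_mul_of_nonneg_left (hT.Abar_mulVec_le hN x) hY)
  set s := ((Abar n G T)ᵀ *ᵥ y) ⬝ᵥ x
  have h1 : (2 * (α * s)) ^ 2 ≤ ((x ⬝ᵥ x + y ⬝ᵥ y) / 2) ^ 2 := by
    have h2 : (2 * (α * a)) ^ 2 ≤ 1 := pow_le_one₀ (by positivity) hαa
    have h3 : (2 * (α * s)) ^ 2 ≤ (2 * (α * a)) ^ 2 * ((x ⬝ᵥ x) * (y ⬝ᵥ y)) := by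
      nlinarith [mul_le_mul_of_nonneg_left hcs (by positivity : 0 ≤ 4 * α ^ 2)]
    nlinarith [mul_nonneg hX hY, sq_nonneg (x ⬝ᵥ x - y ⬝ᵥ y)]
  have h4 := (abs_le_of_sq_le_sq' h1 (by linarith)).1
  linarith

/-- Here a = λ_N, b = λ₂, w = Āᵀy, X = ‖x‖², Y = ‖y‖², W = ‖w‖², S = ‖Āx‖², and g is the gradient
increment. Collecting terms, half of αW absorbs the cross term and the other half absorbs cY; on the
X side, m has to cover αa² + c + αM²/2, which the denominator of α̃ is built to allow. -/
theorem contraction_inequality {a b α m M X Y W S xg gg wg wx : ℝ} (ha : 1 ≤ a) (hb : 0 < b)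
    (hα : 0 < α) (hαm : α * (a ^ 2 + 3 / 4 * a * b ^ 2 + M ^ 2) ≤ m)
    (hX : 0 ≤ X) (hW : 0 ≤ W) (hS : S ≤ a ^ 2 * X) (hYW : b ^ 2 * Y ≤ W)
    (hxg : m * X ≤ xg) (hgg : gg ≤ M ^ 2 * X) {c : ℝ} (hc : c = α * (3 / 4) * (b ^ 2 / (a + 1)))
    (hcs : (wg - 2 * c * wx) ^ 2 ≤ W * (gg - 4 * c * xg + 4 * c ^ 2 * X)) :
    -xg - α * wg - α * W + α * S ≤ -c * (X + Y + 2 * α * wx) := by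
  set k := b ^ 2 / (a + 1) with hk
  have hk0 : 0 < k := by positivity
  have hb2 : 0 < b ^ 2 := by positivity
  have hkb : k * (a + 1) = b ^ 2 := by rw [hk]; field_simp
  have hc0 : 0 < c := by rw [hc]; positivity
  have hkb2 : 2 * k ≤ b ^ 2 := by linarith [mul_le_mul_of_nonneg_left ha hk0.le]
  have hab : b ^ 2 ≤ a * b ^ 2 := le_mul_of_one_le_left hb2.le ha
  set p := 3 / 4 * (a * b ^ 2) with hp
  have hp0 : 0 < p := by positivity
  have hαm' : α * a ^ 2 + α * p + α * M ^ 2 ≤ m := by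
    refine le_trans (le_of_eq ?_) hαm
    rw [hp]; ring
  have hcα : c ≤ α * p / 2 := by
    have h := mul_le_mul_of_nonneg_left (hkb2.trans hab) hα.le
    rw [hc, hp]
    linarith
  have hαa0 : 0 ≤ α * a ^ 2 := by positivity
  have hαp0 : 0 ≤ α * p := by positivity
  have hαM0 : 0 ≤ α * M ^ 2 := by positivity
  have hcm : 0 ≤ m - c := by linarith
  -- The shift of g by 2cx is free: ‖g - 2cx‖² ≤ M²X - 4c(m - c)X and c ≤ m. The rest is the
  -- arithmetic-geometric mean inequality.
  have hq : (wg - 2 * c * wx) ^ 2 ≤ ((W + M ^ 2 * X) / 2) ^ 2 := by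
    have h1 : gg - 4 * c * xg + 4 * c ^ 2 * X ≤ M ^ 2 * X := by
      have h2 : 4 * c * (m * X) ≤ 4 * c * xg := by gcongr
      have h3 : 0 ≤ 4 * c * (m - c) * X := by positivity
      linarith
    have h2 := mul_le_mul_of_nonneg_left h1 hW
    linarith [sq_nonneg (W - M ^ 2 * X)]
  have hq' := (abs_le_of_sq_le_sq' hq (by positivity)).1
  have hcY : c * Y ≤ α * W / 2 := by
    have h1 : 2 * (k * Y) ≤ W := by
      rcases le_total 0 Y with hY | hY
      · linarith [mul_le_mul_of_nonneg_right hkb2 hY]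
      · linarith [mul_nonpos_of_nonneg_of_nonpos hk0.le hY]
    have h2 := mul_le_mul_of_nonneg_left h1 hα.le
    have h3 := mul_nonneg hα.le hW
    rw [hc]
    linarith
  have h5 := mul_le_mul_of_nonneg_left hq' hα.le
  have h6 := mul_le_mul_of_nonneg_left hS hα.le
  have h7 := mul_le_mul_of_nonneg_right hαm' hX
  have h8 := mul_le_mul_of_nonneg_right hcα hX
  have h9 := mul_nonneg hαp0 hX
  have h10 := mul_nonneg hαM0 hX
  linarith

/-- The one-sided Lipschitz estimate behind the contractivity of the projected dynamics. -/
theorem dotProduct_Ptilde_mulVec_le (hN : 2 ≤ N) (hG : G.Connected) (hT : Diagonalizes G T)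
    (hlinf : ∀ i, 0 < linf i) (hε : 0 < ε) (hε1 : ε < 1)
    {x g : Fin N × Fin n → ℝ} (y : Fin (N - 1) × Fin n → ℝ)
    (hxg : (⨅ i, linf i) * (x ⬝ᵥ x) ≤ x ⬝ᵥ g) (hgg : g ⬝ᵥ g ≤ ‖lsup‖ ^ 2 * (x ⬝ᵥ x)) :
    Sum.elim x y ⬝ᵥ Ptilde n hN G T linf lsup ε *ᵥ
        Sum.elim (-g - (Abar n G T)ᵀ *ᵥ y) (Abar n G T *ᵥ x) ≤
      -rate hN G linf lsup ε *
        (Sum.elim x y ⬝ᵥ Ptilde n hN G T linf lsup ε *ᵥ Sum.elim x y) := by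
  have : Nonempty (Fin N) := ⟨⟨0, by omega⟩⟩
  have hm : 0 < ⨅ i, linf i := iInf_pos_of_forall_pos hlinf
  rw [dotProduct_Ptilde_mulVec, dotProduct_Ptilde_mulVec]
  set w := (Abar n G T)ᵀ *ᵥ y with hw
  set c := rate hN G linf lsup ε with hc
  have h1 : y ⬝ᵥ Abar n G T *ᵥ x = w ⬝ᵥ x := by
    rw [hw, mulVec_transpose, ← dotProduct_mulVec]
  have h2 : ((Abar n G T)ᵀ *ᵥ (Abar n G T *ᵥ x)) ⬝ᵥ x =
      (Abar n G T *ᵥ x) ⬝ᵥ (Abar n G T *ᵥ x) := by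
    rw [mulVec_transpose, ← dotProduct_mulVec]
  -- The term -2αc⟨w, x⟩ of the target is merged with the gradient cross term, so Cauchy–Schwarz is
  -- applied once, to w and g - 2cx.
  have hcs := sq_dotProduct_le w (g - (2 * c) • x)
  simp only [dotProduct_sub, sub_dotProduct, dotProduct_smul, smul_dotProduct, smul_eq_mul,
    dotProduct_neg] at hcs ⊢
  rw [h1, h2]
  have key := contraction_inequality (S := (Abar n G T *ᵥ x) ⬝ᵥ (Abar n G T *ᵥ x))
    (wx := w ⬝ᵥ x) (wg := w ⬝ᵥ g) (hT.one_le_lambdaN hN hG) (hT.lambdaTwo_pos hN hG)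
    (alphaTilde_pos (lsup := lsup) hN hG hT hlinf hε)
    ((alphaTilde_mul_eq (linf := linf) (lsup := lsup) (ε := ε) hN hG hT).le.trans
      (mul_le_of_le_one_left hm.le hε1.le)) (dotProduct_self_nonneg' x)
    (dotProduct_self_nonneg' w) (hT.Abar_mulVec_le hN x) (hT.le_transpose_Abar_mulVec hN hG y)
    hxg hgg hc (by
      refine hcs.trans (le_of_eq ?_)
      rw [dotProduct_comm g x]
      ring)
  rw [dotProduct_comm x w]
  linarith

end Ptilde

/-! ### Stacked gradients -/

section Stacked

open Matrix

variable {n N : ℕ} {f : Fin N → EuclideanSpace ℝ (Fin n) → ℝ → ℝ} {linf lsup : Fin N → ℝ}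

theorem block_sub (x x' : Fin N × Fin n → ℝ) (i : Fin N) :
    block (x - x') i = block x i - block x' i := rfl

theorem dotProduct_eq_sum_inner_block (x x' : Fin N × Fin n → ℝ) :
    x ⬝ᵥ x' = ∑ i, inner ℝ (block x i) (block x' i) := by
  simp only [dotProduct, Fintype.sum_prod_type, PiLp.inner_apply, block, RCLike.inner_apply,
    conj_trivial, mul_comm]

theorem dotProduct_self_eq_sum_norm_block (x : Fin N × Fin n → ℝ) :
    x ⬝ᵥ x = ∑ i, ‖block x i‖ ^ 2 := by
  simp only [dotProduct_eq_sum_inner_block, real_inner_self_eq_norm_sq]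

theorem block_consensus (v : EuclideanSpace ℝ (Fin n)) (i : Fin N) :
    block (consensus N v) i = v := rfl

/-- The vector of the gradients `∇ f_i(x^i, t)`. -/
def gradStack (f : Fin N → EuclideanSpace ℝ (Fin n) → ℝ → ℝ) (t : ℝ) (x : Fin N × Fin n → ℝ) :
    Fin N × Fin n → ℝ :=
  fun p => gradAt (f p.1) (block x p.1) t p.2

theorem block_gradStack (t : ℝ) (x : Fin N × Fin n → ℝ) (i : Fin N) :
    block (gradStack f t x) i = gradAt (f i) (block x i) t := rfl

theorem le_norm_pi (v : Fin N → ℝ) (i : Fin N) : v i ≤ ‖v‖ :=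
  (le_abs_self _).trans (norm_le_pi_norm v i)

theorem Diagonalizes.exists_lapKron_mulVec_eq {G : SimpleGraph (Fin N)} [DecidableRel G.Adj]
    {T : Matrix (Fin N) (Fin N) ℝ} (hN : 2 ≤ N) (hT : Diagonalizes G T)
    (hG : G.Connected) {g : Fin N × Fin n → ℝ} (hg : ∀ j, ∑ i, g (i, j) = 0) : ∃ ν, lapKron n G *ᵥ ν = g := by
  choose v hv using fun j => hT.exists_lapMatrix_mulVec_eq hN hG (hg j)
  refine ⟨fun p => v p.2 p.1, ?_⟩
  ext ⟨i, j⟩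
  rw [← congrFun (hv j) i]
  simp only [mulVec, dotProduct, lapKron, kroneckerMap_apply, Fintype.sum_prod_type,
    Matrix.one_apply]
  simp

namespace StandingAssumptions

variable (hf : StandingAssumptions f linf lsup) {t : ℝ} (ht : 0 ≤ t)

include hf

theorem sum_pos [Nonempty (Fin N)] : 0 < ∑ i, linf i :=
  Finset.sum_pos (fun i _ => hf.linf_pos i) Finset.univ_nonempty

theorem norm_lsup_pos [Nonempty (Fin N)] : 0 < ‖lsup‖ :=
  (hf.lsup_pos (Classical.arbitrary _)).trans_le (le_norm_pi lsup _)

include ht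

theorem differentiable (i : Fin N) : Differentiable ℝ fun x => f i x t :=
  (hf.contDiff i t ht).differentiable (by norm_num)

theorem monotone_gradAt (i : Fin N) (x y : EuclideanSpace ℝ (Fin n)) :
    0 ≤ inner ℝ (gradAt (f i) x t - gradAt (f i) y t) (x - y) :=
  (by have := hf.linf_pos i; positivity : 0 ≤ linf i * ‖x - y‖ ^ 2).trans
    (hf.strongConvex i t ht x y)

theorem norm_gradAt_sub_le (i : Fin N) (x y : EuclideanSpace ℝ (Fin n)) :
    ‖gradAt (f i) x t - gradAt (f i) y t‖ ≤ ‖lsup‖ * ‖x - y‖ :=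
  (hf.lipschitzSmooth i t ht x y).trans (by gcongr; exact le_norm_pi lsup i)

theorem le_dotProduct_gradStack_sub (x x' : Fin N × Fin n → ℝ) :
    (⨅ i, linf i) * ((x - x') ⬝ᵥ (x - x')) ≤
      (x - x') ⬝ᵥ (gradStack f t x - gradStack f t x') := by
  rw [dotProduct_self_eq_sum_norm_block, dotProduct_eq_sum_inner_block, Finset.mul_sum]
  refine Finset.sum_le_sum fun i _ => ?_
  rw [block_sub, block_sub, block_gradStack, block_gradStack, real_inner_comm]
  refine le_trans ?_ (hf.strongConvex i t ht _ _)
  gcongr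
  exact ciInf_le (Set.finite_range _).bddBelow i

theorem gradStack_sub_le (x x' : Fin N × Fin n → ℝ) :
    (gradStack f t x - gradStack f t x') ⬝ᵥ (gradStack f t x - gradStack f t x') ≤
      ‖lsup‖ ^ 2 * ((x - x') ⬝ᵥ (x - x')) := by
  rw [dotProduct_self_eq_sum_norm_block, dotProduct_self_eq_sum_norm_block, Finset.mul_sum]
  refine Finset.sum_le_sum fun i _ => ?_
  rw [block_sub, block_sub, block_gradStack, block_gradStack, ← mul_pow]
  exact pow_le_pow_left₀ (norm_nonneg _) (hf.norm_gradAt_sub_le ht i _ _) 2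

theorem linf_le_norm_lsup (hn : 0 < n) (i : Fin N) : linf i ≤ ‖lsup‖ := by
  have : Nontrivial (EuclideanSpace ℝ (Fin n)) := by
    have : Nonempty (Fin n) := ⟨⟨0, hn⟩⟩
    infer_instance
  obtain ⟨x, hx⟩ := exists_ne (0 : EuclideanSpace ℝ (Fin n))
  have h1 := hf.strongConvex i t ht x 0
  have h2 := hf.norm_gradAt_sub_le ht i x 0
  have h3 := real_inner_le_norm (gradAt (f i) x t - gradAt (f i) 0 t) (x - 0)
  have hpos : 0 < ‖x - 0‖ := by rw [sub_zero]; exact norm_pos_iff.mpr hx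
  have h4 : linf i * ‖x - 0‖ ^ 2 ≤ ‖lsup‖ * ‖x - 0‖ ^ 2 := by
    have := mul_le_mul_of_nonneg_right h2 hpos.le
    linarith
  exact le_of_mul_le_mul_right h4 (by positivity)

/-! ### Primal and dual optimizers -/

theorem isOptimizer_iff (v : EuclideanSpace ℝ (Fin n)) :
    IsOptimizer f t v ↔ ∑ i, gradAt (f i) v t = 0 := by
  constructor
  · intro h
    have h1 : IsLocalMin (fun x => ∑ i, f i x t) v := h.isLocalMin Filter.univ_mem
    have h2 : HasFDerivAt (fun x => ∑ i, f i x t)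
        (∑ i, fderiv ℝ (fun x => f i x t) v) v :=
      HasFDerivAt.fun_sum fun i _ => (hf.differentiable ht i v).hasFDerivAt
    have h3 := h1.hasFDerivAt_eq_zero h2
    refine ext_inner_right ℝ fun w => ?_
    rw [sum_inner, inner_zero_left]
    have h4 := congrArg (fun A => A w) h3
    simpa [gradAt] using h4
  · intro h x _
    have h1 : ∑ i, (f i v t + inner ℝ (gradAt (f i) v t) (x - v)) ≤ ∑ i, f i x t :=
      Finset.sum_le_sum fun i _ =>
        add_inner_gradient_le (hf.differentiable ht i) (hf.monotone_gradAt ht i) v x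
    rw [Finset.sum_add_distrib, ← sum_inner, h, inner_zero_left, add_zero] at h1
    exact h1

theorem sum_mul_le_inner_sum_gradAt (x y : EuclideanSpace ℝ (Fin n)) :
    (∑ i, linf i) * ‖x - y‖ ^ 2 ≤
      inner ℝ (∑ i, gradAt (f i) x t - ∑ i, gradAt (f i) y t) (x - y) := by
  rw [← Finset.sum_sub_distrib, sum_inner, Finset.sum_mul]
  exact Finset.sum_le_sum fun i _ => hf.strongConvex i t ht x y

theorem exists_isOptimizer [Nonempty (Fin N)] : ∃ v, IsOptimizer f t v := by
  obtain ⟨v, hv⟩ := exists_zero_of_stronglyMonotone (g := fun x => ∑ i, gradAt (f i) x t)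
    hf.sum_pos (hf.sum_mul_le_inner_sum_gradAt ht) (M := ∑ _i : Fin N, ‖lsup‖) (fun x y => by
      rw [← Finset.sum_sub_distrib, Finset.sum_mul]
      exact (norm_sum_le _ _).trans
        (Finset.sum_le_sum fun i _ => hf.norm_gradAt_sub_le ht i x y))
  exact ⟨v, (hf.isOptimizer_iff ht v).mpr hv⟩

theorem isOptimizer_unique [Nonempty (Fin N)] {v w : EuclideanSpace ℝ (Fin n)}
    (hv : IsOptimizer f t v) (hw : IsOptimizer f t w) : w = v := by
  have h := hf.sum_mul_le_inner_sum_gradAt ht w v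
  rw [(hf.isOptimizer_iff ht v).mp hv, (hf.isOptimizer_iff ht w).mp hw, sub_zero,
    inner_zero_left] at h
  have h1 : ‖w - v‖ ^ 2 ≤ 0 := by
    have := hf.sum_pos
    by_contra! hlt
    nlinarith
  have h2 : ‖w - v‖ = 0 := by nlinarith [norm_nonneg (w - v)]
  exact sub_eq_zero.mp (norm_eq_zero.mp h2)

/-- By convexity, minimality of the Lagrangian is equivalent to stationarity, an equation that can
be subtracted at two different times. -/
theorem isDualOptimizer_iff (G : SimpleGraph (Fin N)) [DecidableRel G.Adj]
    (v : EuclideanSpace ℝ (Fin n)) (ν : Fin N × Fin n → ℝ) :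
    IsDualOptimizer G f t v ν ↔
      gradStack f t (consensus N v) + lapKron n G *ᵥ ν = 0 := by
  have hL : ∀ x, ν ⬝ᵥ lapKron n G *ᵥ x = (lapKron n G *ᵥ ν) ⬝ᵥ x := fun x => by
    rw [dotProduct_mulVec, ← mulVec_transpose, lapKron_transpose]
  constructor
  · intro h
    have h1 : IsLocalMin (fun x => lagrangian G f t x ν) (consensus N v) :=
      h.isLocalMin Filter.univ_mem
    refine dotProduct_eq_zero _ fun w => ?_
    have hblock : ∀ (i : Fin N) (s : ℝ),
        block (consensus N v + s • w) i = v + s • block w i := fun i s => rfl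
    have h2 : HasDerivAt (fun s : ℝ => lagrangian G f t (consensus N v + s • w) ν)
        (∑ i, inner ℝ (gradAt (f i) v t) (block w i) + (lapKron n G *ᵥ ν) ⬝ᵥ w) 0 := by
      simp only [lagrangian, hblock, hL, dotProduct_add, dotProduct_smul, smul_eq_mul]
      refine HasDerivAt.add (HasDerivAt.fun_sum fun i _ => ?_) ?_
      · simpa [gradAt, -inner_gradient_left] using
          hasDerivAt_comp_line (hf.differentiable ht i) v (block w i) 0
      · simpa using ((hasDerivAt_id (0 : ℝ)).mul_const
          ((lapKron n G *ᵥ ν) ⬝ᵥ w)).const_add ((lapKron n G *ᵥ ν) ⬝ᵥ consensus N v)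
    have h3 : IsLocalMin (fun s : ℝ => lagrangian G f t (consensus N v + s • w) ν) 0 :=
      Filter.Eventually.of_forall fun s => by
        simpa using h (Set.mem_univ (consensus N v + s • w))
    have h4 := h3.hasDerivAt_eq_zero h2
    rw [add_dotProduct, dotProduct_eq_sum_inner_block]
    exact h4
  · intro h x _
    have h1 : ∑ i, (f i v t + inner ℝ (gradAt (f i) v t) (block x i - v)) ≤
        ∑ i, f i (block x i) t :=
      Finset.sum_le_sum fun i _ =>
        add_inner_gradient_le (hf.differentiable ht i) (hf.monotone_gradAt ht i) v (block x i)
    have h2 : gradStack f t (consensus N v) ⬝ᵥ (x - consensus N v) +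
        (lapKron n G *ᵥ ν) ⬝ᵥ (x - consensus N v) = 0 := by
      rw [← add_dotProduct, h, zero_dotProduct]
    rw [dotProduct_eq_sum_inner_block, dotProduct_sub] at h2
    rw [Finset.sum_add_distrib] at h1
    simp only [block_sub, block_gradStack, block_consensus] at h2
    simp only [lagrangian, Set.mem_ofPred_eq, hL, block_consensus]
    linarith

/-- At the optimizer the local gradients sum to zero, which is exactly solvability of the
stationarity equation for ν. -/
theorem exists_isDualOptimizer {G : SimpleGraph (Fin N)} [DecidableRel G.Adj]
    {T : Matrix (Fin N) (Fin N) ℝ} (hN : 2 ≤ N) (hG : G.Connected) (hT : Diagonalizes G T)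
    {v : EuclideanSpace ℝ (Fin n)} (hv : IsOptimizer f t v) : ∃ ν, IsDualOptimizer G f t v ν := by
  obtain ⟨ν, hν⟩ := hT.exists_lapKron_mulVec_eq hN hG (g := -gradStack f t (consensus N v))
    (fun j => by
      have h := congrArg (fun w : EuclideanSpace ℝ (Fin n) => w j)
        ((hf.isOptimizer_iff ht v).mp hv)
      simpa [gradStack, block_consensus] using h)
  exact ⟨ν, (hf.isDualOptimizer_iff ht G v ν).mpr (by rw [hν, add_neg_cancel])⟩

end StandingAssumptions

end Stacked

/-! ### The projected dynamics -/

section Dynamics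

open Matrix

variable {n N : ℕ} {G : SimpleGraph (Fin N)} [DecidableRel G.Adj]
  {T : Matrix (Fin N) (Fin N) ℝ} {f : Fin N → EuclideanSpace ℝ (Fin n) → ℝ → ℝ}
  {linf lsup : Fin N → ℝ} {ε : ℝ}

theorem Vmat_mulVec (T : Matrix (Fin N) (Fin N) ℝ) (x ν : Fin N × Fin n → ℝ) :
    Vmat n T *ᵥ Sum.elim x ν = Sum.elim x (rowKron n T *ᵥ ν) := by
  rw [Vmat, fromBlocks_mulVec]
  simp [rowKron]

theorem transpose_Vmat_mulVec (T : Matrix (Fin N) (Fin N) ℝ) (x : Fin N × Fin n → ℝ)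
    (y : Fin (N - 1) × Fin n → ℝ) :
    (Vmat n T)ᵀ *ᵥ Sum.elim x y = Sum.elim x ((rowKron n T)ᵀ *ᵥ y) := by
  rw [Vmat, fromBlocks_transpose, fromBlocks_mulVec]
  simp [rowKron]

theorem pdField_elim (t : ℝ) (x ν : Fin N × Fin n → ℝ) :
    pdField G f t (Sum.elim x ν) =
      Sum.elim (-gradStack f t x - lapKron n G *ᵥ ν) (lapKron n G *ᵥ x) := rfl

theorem Diagonalizes.projField_elim (hT : Diagonalizes G T) (t : ℝ) (x : Fin N × Fin n → ℝ)
    (y : Fin (N - 1) × Fin n → ℝ) :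
    projField G T f t (Sum.elim x y) =
      Sum.elim (-gradStack f t x - (Abar n G T)ᵀ *ᵥ y) (Abar n G T *ᵥ x) := by
  rw [projField, transpose_Vmat_mulVec, pdField_elim, Vmat_mulVec, mulVec_mulVec, mulVec_mulVec,
    hT.lapKron_mul_transpose, hT.rowKron_mul_lapKron]

/-- VᵀV is not the identity, but it only alters ν inside the kernel of L ⊗ I, so V intertwines the
two fields. -/
theorem Diagonalizes.projField_Vmat (hN : 2 ≤ N) (hT : Diagonalizes G T) (t : ℝ)
    (u : (Fin N × Fin n) ⊕ (Fin N × Fin n) → ℝ) :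
    projField G T f t (Vmat n T *ᵥ u) = Vmat n T *ᵥ pdField G f t u := by
  rw [← Sum.elim_comp_inl_inr u, Vmat_mulVec, hT.projField_elim, pdField_elim, Vmat_mulVec,
    mulVec_mulVec, mulVec_mulVec, hT.transpose_Abar_mul_rowKron n hN, hT.rowKron_mul_lapKron]

theorem Diagonalizes.isTrajectory_Vmat (hN : 2 ≤ N) (hT : Diagonalizes G T) {t₀ : ℝ}
    {u : ℝ → (Fin N × Fin n) ⊕ (Fin N × Fin n) → ℝ} (hu : IsTrajectory (pdField G f) t₀ u) :
    IsTrajectory (projField G T f) t₀ (fun t => Vmat n T *ᵥ u t) := fun t ht => by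
  rw [hT.projField_Vmat hN]
  exact (Vmat n T).mulVecLin.toContinuousLinearMap.hasFDerivAt.comp_hasDerivWithinAt t (hu t ht)

theorem Diagonalizes.projField_sub (hT : Diagonalizes G T) (t : ℝ)
    (z w : (Fin N × Fin n) ⊕ (Fin (N - 1) × Fin n) → ℝ) :
    projField G T f t z - projField G T f t w =
      Sum.elim (-(gradStack f t (z ∘ Sum.inl) - gradStack f t (w ∘ Sum.inl)) -
        (Abar n G T)ᵀ *ᵥ ((z - w) ∘ Sum.inr)) (Abar n G T *ᵥ ((z - w) ∘ Sum.inl)) := by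
  conv_lhs => rw [← Sum.elim_comp_inl_inr z, ← Sum.elim_comp_inl_inr w]
  rw [hT.projField_elim, hT.projField_elim]
  have h1 : (z - w) ∘ Sum.inr = z ∘ Sum.inr - w ∘ Sum.inr := rfl
  have h2 : (z - w) ∘ Sum.inl = z ∘ Sum.inl - w ∘ Sum.inl := rfl
  rw [h1, h2, mulVec_sub, mulVec_sub]
  ext (i | i)
  · simp only [Pi.sub_apply, Sum.elim_inl, Pi.neg_apply]; ring
  · simp only [Pi.sub_apply, Sum.elim_inr]

/-! ### Global trajectories and contractivity of the projected system -/

namespace StandingAssumptions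

variable (hf : StandingAssumptions f linf lsup)

include hf

theorem lipschitzWith_gradStack :
    ∃ K : NNReal, ∀ t, 0 ≤ t → LipschitzWith K (gradStack f t) := by
  -- The stacked space carries the supremum norm and each block the Euclidean one; the operator norm
  -- of `B` absorbs the change of norm.
  set B : (Fin N × Fin n → ℝ) →L[ℝ] (Fin N → EuclideanSpace ℝ (Fin n)) :=
    LinearMap.toContinuousLinearMap
      { toFun := fun x i => block x i, map_add' := fun _ _ => rfl, map_smul' := fun _ _ => rfl }
  refine ⟨‖lsup‖₊ * ‖B‖₊, fun t ht => LipschitzWith.of_dist_le_mul fun x y => ?_⟩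
  rw [dist_eq_norm, dist_eq_norm]
  refine (pi_norm_le_iff_of_nonneg (by positivity)).mpr fun p => ?_
  calc ‖(gradStack f t x - gradStack f t y) p‖
      = ‖(gradAt (f p.1) (block x p.1) t - gradAt (f p.1) (block y p.1) t) p.2‖ := rfl
    _ ≤ ‖gradAt (f p.1) (block x p.1) t - gradAt (f p.1) (block y p.1) t‖ :=
        PiLp.norm_apply_le _ _
    _ ≤ ‖lsup‖ * ‖B (x - y) p.1‖ := hf.norm_gradAt_sub_le ht p.1 _ _
    _ ≤ ‖lsup‖ * (‖B‖ * ‖x - y‖) := by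
        gcongr
        exact (norm_le_pi_norm _ p.1).trans (B.le_opNorm _)
    _ = ‖lsup‖ * ‖B‖ * ‖x - y‖ := by ring

theorem lipschitzWith_projField (G : SimpleGraph (Fin N)) [DecidableRel G.Adj]
    (T : Matrix (Fin N) (Fin N) ℝ) :
    ∃ K : NNReal, ∀ t, 0 ≤ t → LipschitzWith K (projField G T f t) := by
  obtain ⟨K, hK⟩ := hf.lipschitzWith_gradStack
  have hL := (lapKron n G).mulVecLin.toContinuousLinearMap.lipschitz
  have hV := (Vmat n T).mulVecLin.toContinuousLinearMap.lipschitz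
  have hVt := (Vmat n T)ᵀ.mulVecLin.toContinuousLinearMap.lipschitz
  set KL := ‖(lapKron n G).mulVecLin.toContinuousLinearMap‖₊
  have hproj : ∀ (σ : Fin N × Fin n → (Fin N × Fin n) ⊕ (Fin N × Fin n)),
      LipschitzWith 1 (fun u : (Fin N × Fin n) ⊕ (Fin N × Fin n) → ℝ => u ∘ σ) := fun σ =>
    LipschitzWith.of_dist_le_mul fun u v => by
      rw [NNReal.coe_one, one_mul]
      exact (dist_pi_le_iff dist_nonneg).mpr fun p => dist_le_pi_dist u v (σ p)
  have hpd : ∀ t, 0 ≤ t → LipschitzWith (K * 1 + KL * 1 + KL * 1) (pdField G f t) := fun t ht => by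
    have h1 := (((hK t ht).comp (hproj Sum.inl)).neg).sub (hL.comp (hproj Sum.inr))
    have h2 := hL.comp (hproj Sum.inl)
    refine LipschitzWith.of_dist_le_mul fun u v => (dist_pi_le_iff (by positivity)).mpr ?_
    have hKL : (0 : ℝ) ≤ (KL * 1 : NNReal) * dist u v := by positivity
    have hK0 : (0 : ℝ) ≤ (K * 1 + KL * 1 : NNReal) * dist u v := by positivity
    rintro (p | p)
    · have h := (dist_le_pi_dist _ _ p).trans (h1.dist_le_mul u v)
      refine h.trans ?_
      rw [NNReal.coe_add (K * 1 + KL * 1), add_mul]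
      exact le_add_of_nonneg_right hKL
    · have h := (dist_le_pi_dist _ _ p).trans (h2.dist_le_mul u v)
      refine h.trans ?_
      rw [NNReal.coe_add (K * 1 + KL * 1), add_mul]
      exact le_add_of_nonneg_left hK0
  exact ⟨_, fun t ht => hV.comp ((hpd t ht).comp hVt)⟩

theorem continuousOn_projField (G : SimpleGraph (Fin N)) [DecidableRel G.Adj]
    (T : Matrix (Fin N) (Fin N) ℝ) (z : (Fin N × Fin n) ⊕ (Fin (N - 1) × Fin n) → ℝ) :
    ContinuousOn (fun t => projField G T f t z) (Set.Ici 0) := by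
  refine (Vmat n T).mulVecLin.toContinuousLinearMap.continuous.comp_continuousOn ?_
  refine continuousOn_pi.mpr ?_
  rintro (p | p)
  · refine ContinuousOn.sub (ContinuousOn.neg ?_) continuousOn_const
    exact (EuclideanSpace.proj (𝕜 := ℝ) p.2).continuous.comp_continuousOn
      (hf.contDiff_time p.1 _).continuousOn
  · exact continuousOn_const

theorem exists_isTrajectory (G : SimpleGraph (Fin N)) [DecidableRel G.Adj]
    (T : Matrix (Fin N) (Fin N) ℝ) {t₀ : ℝ} (ht₀ : 0 ≤ t₀)
    (z₀ : (Fin N × Fin n) ⊕ (Fin (N - 1) × Fin n) → ℝ) :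
    ∃ z, IsTrajectory (projField G T f) t₀ z ∧ z t₀ = z₀ := by
  obtain ⟨K, hK⟩ := hf.lipschitzWith_projField G T
  exact exists_forall_hasDerivWithinAt_Ici (fun t ht => hK t (ht₀.trans ht))
    (fun z => (hf.continuousOn_projField G T z).mono (Set.Ici_subset_Ici.mpr ht₀)) z₀

theorem posDef_Ptilde (hN : 2 ≤ N) (hG : G.Connected) (hT : Diagonalizes G T) (hε0 : 0 < ε)
    (hε1 : ε < 1) : (Ptilde n hN G T linf lsup ε).PosDef :=
  Ptilde_posDef hN hG hT hf.linf_pos hε0 hε1 fun hn =>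
    (ciInf_le (Set.finite_range _).bddBelow ⟨0, by omega⟩).trans
      (hf.linf_le_norm_lsup le_rfl hn _)

theorem inner_sqrtMap_projField_sub_le (hN : 2 ≤ N) (hG : G.Connected) (hT : Diagonalizes G T)
    (hε0 : 0 < ε) (hε1 : ε < 1) {t : ℝ} (ht : 0 ≤ t)
    (z w : (Fin N × Fin n) ⊕ (Fin (N - 1) × Fin n) → ℝ) :
    inner ℝ (sqrtMap (Ptilde n hN G T linf lsup ε) (projField G T f t z - projField G T f t w))
        (sqrtMap (Ptilde n hN G T linf lsup ε) (z - w)) ≤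
      -rate hN G linf lsup ε * ‖sqrtMap (Ptilde n hN G T linf lsup ε) (z - w)‖ ^ 2 := by
  have hP := (hf.posDef_Ptilde (G := G) hN hG hT hε0 hε1).posSemidef
  rw [inner_sqrtMap hP, norm_sqrtMap, sqrtNorm_sq hP, hT.projField_sub]
  rw [← Sum.elim_comp_inl_inr (z - w)]
  exact dotProduct_Ptilde_mulVec_le hN hG hT hf.linf_pos hε0 hε1 _
    (hf.le_dotProduct_gradStack_sub ht _ _) (hf.gradStack_sub_le ht _ _)

theorem isContractive_projField (hN : 2 ≤ N) (hG : G.Connected) (hT : Diagonalizes G T)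
    (hε0 : 0 < ε) (hε1 : ε < 1) :
    IsContractive (projField G T f) (sqrtNorm (Ptilde n hN G T linf lsup ε))
      (rate hN G linf lsup ε) := by
  have hc := rate_pos (lsup := lsup) hN hG hT hf.linf_pos hε0
  refine ⟨hc, fun t₀ ht₀ u₀ => hf.exists_isTrajectory G T ht₀ u₀,
    fun t₀ ht₀ u v hu hv t ht => ?_⟩
  set Q := sqrtMap (Ptilde n hN G T linf lsup ε)
  have h := tracking_bound (ζ := fun s => Q (u s - v s))
    (ζ' := fun s => Q (projField G T f s (u s) - projField G T f s (v s)))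
    (ω := fun _ => 0) (ρ := 0) hc
    (fun s hs => Q.hasFDerivAt.comp_hasDerivWithinAt s ((hu s hs).sub (hv s hs)))
    (by simp) (fun s hs => by
      simpa using hf.inner_sqrtMap_projField_sub_le hN hG hT hε0 hε1 (ht₀.trans hs) (u s) (v s))
    (fun s hs h => by
      rw [sub_zero, sqrtMap_eq_zero_iff (hf.posDef_Ptilde hN hG hT hε0 hε1), sub_eq_zero] at h
      rw [h, sub_self, map_zero]) ht
  simp only [sub_zero, zero_div, add_zero] at h
  exact h

end StandingAssumptions

end Dynamics

/-! ### Speed of the optimal trajectory -/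

section Perturbation

variable {E : Type*} [NormedAddCommGroup E] [InnerProductSpace ℝ E] {ι : Type*} [Fintype ι]
  {b h : ι → E} {Δ : E} {β : ι → ℝ} {σ M : ℝ}

/-- In the application Δ is the displacement of the optimizer, b i the change of the i-th gradient
due to time alone, and h i the change due to Δ. The sum vanishes because both endpoints are optimal.
-/
theorem norm_le_of_sum_add_eq_zero (hσ : 0 < σ) (hsum : ∑ i, (b i + h i) = 0)
    (hmono : σ * ‖Δ‖ ^ 2 ≤ inner ℝ (∑ i, h i) Δ) (hb : ∀ i, ‖b i‖ ≤ β i) :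
    ‖Δ‖ ≤ (∑ i, β i) / σ := by
  have h1 : ∑ i, h i = -∑ i, b i := by
    rw [Finset.sum_add_distrib] at hsum
    exact eq_neg_of_add_eq_zero_right hsum
  have h2 : ‖∑ i, h i‖ ≤ ∑ i, β i := by
    rw [h1, norm_neg]
    exact norm_sum_le_of_le _ fun i _ => hb i
  have h3 := (hmono.trans (real_inner_le_norm _ _)).trans
    (mul_le_mul_of_nonneg_right h2 (norm_nonneg Δ))
  rcases (norm_nonneg Δ).eq_or_lt with h0 | h0
  · rw [← h0]
    exact div_nonneg ((norm_nonneg _).trans h2) hσ.le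
  · rw [le_div_iff₀ hσ]
    exact le_of_mul_le_mul_right (by linarith) h0

/-- Cocoercivity places h in the ball with diameter [0, MΔ], so h is within M‖Δ‖/2 of MΔ/2. The last
term is kept because it cancels upon summation over agents. -/
theorem norm_add_sq_le_of_cocoercive {b h Δ : E} (hM : 0 ≤ M)
    (hcoc : ‖h‖ ^ 2 ≤ M * inner ℝ h Δ) :
    ‖b + h‖ ^ 2 ≤ ‖b‖ ^ 2 + M * ‖Δ‖ * ‖b‖ + M * inner ℝ (b + h) Δ := by
  have h1 : ‖h - (M / 2) • Δ‖ ≤ M / 2 * ‖Δ‖ := by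
    refine (abs_le_of_sq_le_sq' ?_ (by positivity)).2
    rw [norm_sub_sq_real, inner_smul_right, norm_smul, mul_pow, mul_pow, Real.norm_eq_abs, sq_abs]
    linarith
  have h2 := (real_inner_le_norm b (h - (M / 2) • Δ)).trans
    (mul_le_mul_of_nonneg_left h1 (norm_nonneg b))
  rw [inner_sub_right, inner_smul_right] at h2
  rw [norm_add_sq_real, inner_add_left, mul_add]
  linarith

/-- Bounding each ‖h i‖ by M‖Δ‖ separately would cost a factor √N. Cocoercivity avoids this, since
the terms M⟨b i + h i, Δ⟩ sum to zero. -/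
theorem sum_norm_add_sq_le (hσ : 0 < σ) (hM : 0 ≤ M) (hsum : ∑ i, (b i + h i) = 0)
    (hmono : σ * ‖Δ‖ ^ 2 ≤ inner ℝ (∑ i, h i) Δ)
    (hcoc : ∀ i, ‖h i‖ ^ 2 ≤ M * inner ℝ (h i) Δ) (hb : ∀ i, ‖b i‖ ≤ β i) :
    ∑ i, ‖b i + h i‖ ^ 2 ≤ ((∑ i, β i) * (M / σ + 1)) ^ 2 := by
  have hΔ := norm_le_of_sum_add_eq_zero hσ hsum hmono hb
  have hβ : ∀ i, 0 ≤ β i := fun i => (norm_nonneg _).trans (hb i)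
  have hB : 0 ≤ ∑ i, β i := Finset.sum_nonneg fun i _ => hβ i
  have h1 : ∑ i, ‖b i + h i‖ ^ 2 ≤
      ∑ i, (β i ^ 2 + M * ‖Δ‖ * β i + M * inner ℝ (b i + h i) Δ) :=
    Finset.sum_le_sum fun i _ => (norm_add_sq_le_of_cocoercive hM (hcoc i)).trans
      (by gcongr <;> exact hb i)
  rw [Finset.sum_add_distrib, Finset.sum_add_distrib, ← Finset.mul_sum, ← Finset.mul_sum,
    ← sum_inner, hsum, inner_zero_left, mul_zero, add_zero] at h1
  have h2 : ∑ i, β i ^ 2 ≤ (∑ i, β i) ^ 2 :=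
    Finset.sum_sq_le_sq_sum_of_nonneg fun i _ => hβ i
  have h3 : M * ‖Δ‖ * ∑ i, β i ≤ M * ((∑ i, β i) / σ) * ∑ i, β i := by gcongr
  have h4 : M * ((∑ i, β i) / σ) * ∑ i, β i = M / σ * (∑ i, β i) ^ 2 := by ring
  have h5 : 0 ≤ M / σ * (∑ i, β i) ^ 2 := by positivity
  have h6 : 0 ≤ (M / σ) ^ 2 * (∑ i, β i) ^ 2 := by positivity
  linarith

end Perturbation

/-! ### Tracking of the moving equilibrium -/

section Tracking

open Matrix

variable {n N : ℕ} {G : SimpleGraph (Fin N)} [DecidableRel G.Adj]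
  {T : Matrix (Fin N) (Fin N) ℝ} {f : Fin N → EuclideanSpace ℝ (Fin n) → ℝ → ℝ}
  {linf lsup : Fin N → ℝ} {ε : ℝ}

theorem lambdaMax_nonneg {ι : Type*} [Fintype ι] [DecidableEq ι] {P : Matrix ι ι ℝ}
    (hP : P.PosSemidef) : 0 ≤ lambdaMax P :=
  Real.sSup_nonneg fun _ hx => spectrum_nonneg_of_nonneg hP.nonneg hx

/-- The natural factor is λmax; its square suffices because a unit diagonal entry forces λmax ≥ 1.
This is why ρ carries λmax(P̃) and not its square root. -/
theorem dotProduct_Ptilde_mulVec_self_le (hN : 2 ≤ N)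
    (z : (Fin N × Fin n) ⊕ (Fin (N - 1) × Fin n) → ℝ) :
    z ⬝ᵥ Ptilde n hN G T linf lsup ε *ᵥ z ≤
      lambdaMax (Ptilde n hN G T linf lsup ε) ^ 2 * (z ⬝ᵥ z) := by
  rcases n.eq_zero_or_pos with rfl | hn
  · have : z = 0 := by ext (i | i) <;> exact i.2.elim0
    simp [this]
  · have hH : (Ptilde n hN G T linf lsup ε).IsHermitian := Ptilde_isHermitian
    have h1 : 1 ≤ lambdaMax (Ptilde n hN G T linf lsup ε) := by
      have h := dotProduct_mulVec_le_lambdaMax hH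
        (Sum.elim (Pi.single (⟨0, by omega⟩, ⟨0, hn⟩) 1) 0)
      rw [dotProduct_Ptilde_mulVec, sumElim_dotProduct_sumElim] at h
      simpa using h
    refine (dotProduct_mulVec_le_lambdaMax hH z).trans ?_
    exact mul_le_mul_of_nonneg_right (by nlinarith) (dotProduct_self_nonneg' z)

theorem dotProduct_consensus_self (v : EuclideanSpace ℝ (Fin n)) :
    consensus N v ⬝ᵥ consensus N v = N * ‖v‖ ^ 2 := by
  rw [dotProduct_self_eq_sum_norm_block]
  simp [block_consensus]

namespace StandingAssumptions

variable (hf : StandingAssumptions f linf lsup)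

include hf

theorem norm_gradAt_sub_le_of_norm_derivWithin_le {i : Fin N} {β : ℝ}
    {x : EuclideanSpace ℝ (Fin n)}
    (hβ : ∀ t : ℝ, 0 ≤ t → ‖derivWithin (fun s => gradAt (f i) x s) (Set.Ici 0) t‖ ≤ β)
    {s t : ℝ} (hs : 0 ≤ s) (ht : 0 ≤ t) :
    ‖gradAt (f i) x t - gradAt (f i) x s‖ ≤ β * |t - s| :=
  (convex_Ici 0).norm_image_sub_le_of_norm_derivWithin_le
    ((hf.contDiff_time i x).differentiableOn (by norm_num)) hβ hs ht

/-- The speed of the optimal primal and (projected) dual variables. -/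
theorem optimizer_lipschitz (hN : 2 ≤ N) (hG : G.Connected) (hT : Diagonalizes G T)
    {β : Fin N → ℝ}
    (hβ : ∀ i, ∀ x : EuclideanSpace ℝ (Fin n), ∀ t : ℝ, 0 ≤ t →
      ‖derivWithin (fun s => gradAt (f i) x s) (Set.Ici 0) t‖ ≤ β i)
    {s t : ℝ} (hs : 0 ≤ s) (ht : 0 ≤ t) {v w : EuclideanSpace ℝ (Fin n)}
    {ν μ : Fin N × Fin n → ℝ} (hv : IsOptimizer f s v) (hν : IsDualOptimizer G f s v ν)
    (hw : IsOptimizer f t w) (hμ : IsDualOptimizer G f t w μ) :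
    ‖w - v‖ ≤ (∑ i, β i) / (∑ i, linf i) * |t - s| ∧
      lambdaTwo hN G ^ 2 * ((rowKron n T *ᵥ μ - rowKron n T *ᵥ ν) ⬝ᵥ
        (rowKron n T *ᵥ μ - rowKron n T *ᵥ ν)) ≤
      ((∑ i, β i) * (‖lsup‖ / (∑ i, linf i) + 1) * |t - s|) ^ 2 := by
  have : Nonempty (Fin N) := ⟨⟨0, by omega⟩⟩
  set b : Fin N → EuclideanSpace ℝ (Fin n) := fun i => gradAt (f i) v t - gradAt (f i) v s with hb
  set h : Fin N → EuclideanSpace ℝ (Fin n) := fun i => gradAt (f i) w t - gradAt (f i) v t with hh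
  have hbh : ∀ i, b i + h i = gradAt (f i) w t - gradAt (f i) v s := fun i => by
    simp only [hb, hh]; abel
  have hsum : ∑ i, (b i + h i) = 0 := by
    simp only [hbh]
    rw [Finset.sum_sub_distrib, (hf.isOptimizer_iff ht w).mp hw, (hf.isOptimizer_iff hs v).mp hv,
      sub_zero]
  have hmono : (∑ i, linf i) * ‖w - v‖ ^ 2 ≤ inner ℝ (∑ i, h i) (w - v) := by
    have := hf.sum_mul_le_inner_sum_gradAt ht w v
    rwa [← Finset.sum_sub_distrib] at this
  have hcoc : ∀ i, ‖h i‖ ^ 2 ≤ ‖lsup‖ * inner ℝ (h i) (w - v) := fun i =>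
    norm_sq_gradient_sub_le (hf.differentiable ht i) hf.norm_lsup_pos (hf.monotone_gradAt ht i)
      (hf.norm_gradAt_sub_le ht i) w v
  have hbβ : ∀ i, ‖b i‖ ≤ β i * |t - s| := fun i =>
    hf.norm_gradAt_sub_le_of_norm_derivWithin_le (hβ i v) hs ht
  constructor
  · have h1 := norm_le_of_sum_add_eq_zero hf.sum_pos hsum hmono hbβ
    rwa [← Finset.sum_mul, mul_div_right_comm] at h1
  · have h1 := sum_norm_add_sq_le hf.sum_pos (norm_nonneg lsup) hsum hmono hcoc hbβ
    have h2 := hT.le_transpose_Abar_mulVec hN hG (rowKron n T *ᵥ μ - rowKron n T *ᵥ ν)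
    refine h2.trans ?_
    -- Subtracting stationarity at the two times expresses the dual increment through gradient
    -- increments.
    have h3 : (Abar n G T)ᵀ *ᵥ (rowKron n T *ᵥ μ - rowKron n T *ᵥ ν) =
        -(gradStack f t (consensus N w) - gradStack f s (consensus N v)) := by
      rw [mulVec_sub, mulVec_mulVec, mulVec_mulVec, hT.transpose_Abar_mul_rowKron n hN,
        eq_neg_of_add_eq_zero_right ((hf.isDualOptimizer_iff hs G v ν).mp hν),
        eq_neg_of_add_eq_zero_right ((hf.isDualOptimizer_iff ht G w μ).mp hμ)]
      abel
    rw [h3, neg_dotProduct_neg, dotProduct_self_eq_sum_norm_block]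
    rw [← Finset.sum_mul] at h1
    simp only [hbh] at h1
    refine le_trans h1 (le_of_eq ?_)
    ring

theorem norm_sqrtMap_optimizer_sub_le (hN : 2 ≤ N) (hG : G.Connected) (hT : Diagonalizes G T)
    (hε0 : 0 < ε) (hε1 : ε < 1) {β : Fin N → ℝ} (hβ0 : ∀ i, 0 < β i)
    (hβ : ∀ i, ∀ x : EuclideanSpace ℝ (Fin n), ∀ t : ℝ, 0 ≤ t →
      ‖derivWithin (fun s => gradAt (f i) x s) (Set.Ici 0) t‖ ≤ β i)
    {s t : ℝ} (hs : 0 ≤ s) (ht : 0 ≤ t) {v w : EuclideanSpace ℝ (Fin n)}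
    {ν μ : Fin N × Fin n → ℝ} (hv : IsOptimizer f s v) (hν : IsDualOptimizer G f s v ν)
    (hw : IsOptimizer f t w) (hμ : IsDualOptimizer G f t w μ) :
    ‖sqrtMap (Ptilde n hN G T linf lsup ε) (Vmat n T *ᵥ Sum.elim (consensus N w) μ) -
        sqrtMap (Ptilde n hN G T linf lsup ε) (Vmat n T *ᵥ Sum.elim (consensus N v) ν)‖ ≤
      rho n hN G T linf lsup ε β * |t - s| := by
  have : Nonempty (Fin N) := ⟨⟨0, by omega⟩⟩
  have hP := (hf.posDef_Ptilde (G := G) hN hG hT hε0 hε1).posSemidef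
  obtain ⟨h1, h2⟩ := hf.optimizer_lipschitz hN hG hT hβ hs ht hv hν hw hμ
  have hlam := lambdaMax_nonneg hP
  have hquad := dotProduct_Ptilde_mulVec_self_le (G := G) (T := T) (linf := linf) (lsup := lsup)
    (ε := ε) hN
    (Sum.elim (consensus N (w - v)) (rowKron n T *ᵥ μ - rowKron n T *ᵥ ν))
  have hdiff : Vmat n T *ᵥ Sum.elim (consensus N w) μ - Vmat n T *ᵥ Sum.elim (consensus N v) ν =
      Sum.elim (consensus N (w - v)) (rowKron n T *ᵥ μ - rowKron n T *ᵥ ν) := by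
    rw [Vmat_mulVec, Vmat_mulVec]
    ext (p | p) <;> rfl
  rw [← map_sub, hdiff]
  have hσ := hf.sum_pos
  have hl2 := hT.lambdaTwo_pos hN hG
  have hB : 0 < ∑ i, β i := Finset.sum_pos (fun i _ => hβ0 i) Finset.univ_nonempty
  have habs : ∑ i, |β i| = ∑ i, β i := Finset.sum_congr rfl fun i _ => abs_of_pos (hβ0 i)
  have habs' : ∑ i, |linf i| = ∑ i, linf i :=
    Finset.sum_congr rfl fun i _ => abs_of_pos (hf.linf_pos i)
  rw [rho, habs, habs']
  rw [sumElim_dotProduct_sumElim, dotProduct_consensus_self] at hquad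
  set lam := lambdaMax (Ptilde n hN G T linf lsup ε)
  set σ := ∑ i, linf i
  set B := ∑ i, β i
  set r := |t - s|
  have hr : 0 ≤ r := abs_nonneg _
  set y := rowKron n T *ᵥ μ - rowKron n T *ᵥ ν
  refine (abs_le_of_sq_le_sq' ?_ (by positivity)).2
  rw [norm_sqrtMap, sqrtNorm_sq hP]
  have hN1 : (1 : ℝ) ≤ N := by exact_mod_cast (by omega : 1 ≤ N)
  -- The consensus vector only brings √N; relaxing N to N² produces the factor N of ρ.
  have hx : N * ‖w - v‖ ^ 2 ≤ (B / σ * N * r) ^ 2 := by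
    calc N * ‖w - v‖ ^ 2 ≤ (N * N) * (B / σ * r) ^ 2 := by
          gcongr
          exact le_mul_of_one_le_left (by positivity) hN1
      _ = (B / σ * N * r) ^ 2 := by ring
  have hy : y ⬝ᵥ y ≤ (B / lambdaTwo hN G * (‖lsup‖ / σ + 1) * r) ^ 2 := by
    have h3 : (B / lambdaTwo hN G * (‖lsup‖ / σ + 1) * r) ^ 2 =
        (B * (‖lsup‖ / σ + 1) * r) ^ 2 / lambdaTwo hN G ^ 2 := by
      field_simp
    rw [h3, le_div_iff₀ (by positivity)]
    linarith
  set p := B / σ * N * r with hp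
  set q := B / lambdaTwo hN G * (‖lsup‖ / σ + 1) * r with hq
  have hp0 : 0 ≤ p := by positivity
  have hq0 : 0 ≤ q := by positivity
  calc _ ≤ lam ^ 2 * (N * ‖w - v‖ ^ 2 + y ⬝ᵥ y) := hquad
    _ ≤ lam ^ 2 * (p + q) ^ 2 := by
        gcongr
        nlinarith [mul_nonneg hp0 hq0]
    _ = _ := by rw [hp, hq]; ring

theorem projField_optimizer_eq_zero (hN : 2 ≤ N) (hT : Diagonalizes G T) {t : ℝ} (ht : 0 ≤ t)
    {v : EuclideanSpace ℝ (Fin n)} {ν : Fin N × Fin n → ℝ} (hν : IsDualOptimizer G f t v ν) :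
    projField G T f t (Vmat n T *ᵥ Sum.elim (consensus N v) ν) = 0 := by
  have h1 : lapKron n G *ᵥ consensus N v = 0 := by
    ext ⟨i, j⟩
    have h := congrFun (G.lapMatrix_mulVec_const_eq_zero (R := ℝ)) i
    simp only [mulVec, dotProduct, mul_one, Pi.zero_apply] at h
    simp only [mulVec, dotProduct, lapKron, kroneckerMap_apply, Fintype.sum_prod_type,
      Matrix.one_apply, consensus, Pi.zero_apply]
    simp [← Finset.sum_mul, h]
  have h2 : pdField G f t (Sum.elim (consensus N v) ν) = 0 := by
    rw [pdField_elim, h1, ← neg_add', (hf.isDualOptimizer_iff ht G v ν).mp hν, neg_zero]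
    exact Sum.elim_zero_zero
  rw [hT.projField_Vmat hN, h2, mulVec_zero]

/-- The selection `νs` may be irregular in time: only its projection enters, and that is Lipschitz.
As z* is a zero of the field at each time, the velocity of z equals the field difference that the
contraction estimate controls. -/
theorem tracking (hN : 2 ≤ N) (hG : G.Connected) (hT : Diagonalizes G T)
    (hε0 : 0 < ε) (hε1 : ε < 1) {β : Fin N → ℝ} (hβ0 : ∀ i, 0 < β i)
    (hβ : ∀ i, ∀ x : EuclideanSpace ℝ (Fin n), ∀ t : ℝ, 0 ≤ t →
      ‖derivWithin (fun s => gradAt (f i) x s) (Set.Ici 0) t‖ ≤ β i)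
    {xs : ℝ → EuclideanSpace ℝ (Fin n)} {νs : ℝ → Fin N × Fin n → ℝ}
    (hopt : ∀ t : ℝ, 0 ≤ t → IsOptimizer f t (xs t) ∧ IsDualOptimizer G f t (xs t) (νs t))
    {z : ℝ → (Fin N × Fin n) ⊕ (Fin (N - 1) × Fin n) → ℝ}
    (hz : IsTrajectory (projField G T f) 0 z) {t : ℝ} (ht : 0 ≤ t) :
    sqrtNorm (Ptilde n hN G T linf lsup ε)
        (z t - Vmat n T *ᵥ Sum.elim (consensus N (xs t)) (νs t)) ≤
      (sqrtNorm (Ptilde n hN G T linf lsup ε)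
          (z 0 - Vmat n T *ᵥ Sum.elim (consensus N (xs 0)) (νs 0)) -
        rho n hN G T linf lsup ε β / rate hN G linf lsup ε) *
          Real.exp (-rate hN G linf lsup ε * t) +
        rho n hN G T linf lsup ε β / rate hN G linf lsup ε := by
  set Q := sqrtMap (Ptilde n hN G T linf lsup ε)
  set zs := fun s => Vmat n T *ᵥ Sum.elim (consensus N (xs s)) (νs s) with hzs
  have hstat : ∀ s, 0 ≤ s → projField G T f s (zs s) = 0 := fun s hs =>
    hf.projField_optimizer_eq_zero hN hT hs (hopt s hs).2
  have h := tracking_bound (ζ := fun s => Q (z s)) (ζ' := fun s => Q (projField G T f s (z s)))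
    (ω := fun s => Q (zs s)) (t₀ := 0) (ρ := rho n hN G T linf lsup ε β)
    (rate_pos (G := G) (lsup := lsup) hN hG hT hf.linf_pos hε0)
    (fun s hs => Q.hasFDerivAt.comp_hasDerivWithinAt s (hz s hs))
    (fun s hs r hr => hf.norm_sqrtMap_optimizer_sub_le hN hG hT hε0 hε1 hβ0 hβ hs hr
      (hopt s hs).1 (hopt s hs).2 (hopt r hr).1 (hopt r hr).2)
    (fun s hs => by
      have := hf.inner_sqrtMap_projField_sub_le (T := T) hN hG hT hε0 hε1 hs (z s) (zs s)
      rwa [hstat s hs, sub_zero, map_sub] at this)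
    (fun s hs h0 => by
      rw [← map_sub, sqrtMap_eq_zero_iff (hf.posDef_Ptilde hN hG hT hε0 hε1), sub_eq_zero] at h0
      simp only [h0, hstat s hs, map_zero]) ht
  simp only [sub_zero, ← map_sub] at h
  exact h

end StandingAssumptions

end Tracking

theorem eventually_le_of_le_exp {err : ℝ → ℝ} {a b c : ℝ} (hc : 0 < c)
    (h : ∀ t, 0 ≤ t → err t ≤ a * Real.exp (-c * t) + b) {η : ℝ} (hη : 0 < η) :
    ∀ᶠ t in Filter.atTop, err t ≤ b + η := by
  have h1 : Filter.Tendsto (fun t => a * Real.exp (-c * t)) Filter.atTop (nhds (a * 0)) :=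
    (Real.tendsto_exp_atBot.comp
      (Filter.tendsto_id.const_mul_atTop_of_neg (neg_neg_of_pos hc))).const_mul a
  rw [mul_zero] at h1
  filter_upwards [h1.eventually_lt_const hη, Filter.eventually_ge_atTop 0] with t h2 h3
  linarith [h t h3]

end TVDistOpt

end

theorem theorem5 {n N : ℕ} (hN : 2 ≤ N) (G : SimpleGraph (Fin N)) [DecidableRel G.Adj]
    (hG : G.Connected) (T : Matrix (Fin N) (Fin N) ℝ) (hT : TVDistOpt.Diagonalizes G T)
    (f : Fin N → EuclideanSpace ℝ (Fin n) → ℝ → ℝ) (linf lsup : Fin N → ℝ)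
    (hf : TVDistOpt.StandingAssumptions f linf lsup) (ε : ℝ) (hε0 : 0 < ε) (hε1 : ε < 1) :
    -- the weight `P̃` is positive definite, so that `‖·‖_{2,P̃^{1/2}}` is a norm
    (TVDistOpt.Ptilde n hN G T linf lsup ε).PosDef ∧
    -- at each time the optimizer `x*(t)` exists and is unique, and dual optimizers exist
    (∀ t : ℝ, 0 ≤ t → ∃ v, TVDistOpt.IsOptimizer f t v ∧
      (∀ w, TVDistOpt.IsOptimizer f t w → w = v) ∧ ∃ ν, TVDistOpt.IsDualOptimizer G f t v ν) ∧
    -- `z = V (x, ν)` obeys the projected system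
    (∀ u, TVDistOpt.IsTrajectory (TVDistOpt.pdField G f) 0 u →
      TVDistOpt.IsTrajectory (TVDistOpt.projField G T f) 0
        (fun t => (TVDistOpt.Vmat n T).mulVec (u t))) ∧
    -- the projected system is contractive with rate `c`
    TVDistOpt.IsContractive (TVDistOpt.projField G T f)
      (TVDistOpt.sqrtNorm (TVDistOpt.Ptilde n hN G T linf lsup ε))
      (TVDistOpt.rate hN G linf lsup ε) ∧
    -- tracking of the time-varying optimizers
    ∀ β : Fin N → ℝ, (∀ i, 0 < β i) →
      (∀ i, ∀ x : EuclideanSpace ℝ (Fin n), ∀ t : ℝ, 0 ≤ t →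
        ‖derivWithin (fun s => TVDistOpt.gradAt (f i) x s) (Set.Ici 0) t‖ ≤ β i) →
      ∀ (xs : ℝ → EuclideanSpace ℝ (Fin n)) (νs : ℝ → Fin N × Fin n → ℝ),
        (∀ t : ℝ, 0 ≤ t → TVDistOpt.IsOptimizer f t (xs t) ∧
          TVDistOpt.IsDualOptimizer G f t (xs t) (νs t)) →
        ∀ u, TVDistOpt.IsTrajectory (TVDistOpt.pdField G f) 0 u →
        let err : ℝ → ℝ := fun t =>
          TVDistOpt.sqrtNorm (TVDistOpt.Ptilde n hN G T linf lsup ε)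
            ((TVDistOpt.Vmat n T).mulVec (u t) -
              (TVDistOpt.Vmat n T).mulVec (Sum.elim (TVDistOpt.consensus N (xs t)) (νs t)))
        let c : ℝ := TVDistOpt.rate hN G linf lsup ε
        let ρ : ℝ := TVDistOpt.rho n hN G T linf lsup ε β
        (∀ t : ℝ, 0 ≤ t → err t ≤ (err 0 - ρ / c) * Real.exp (-c * t) + ρ / c) ∧
          ∀ η : ℝ, 0 < η → ∀ᶠ t in Filter.atTop, err t ≤ ρ / c + η := by
  have hc := TVDistOpt.rate_pos (lsup := lsup) hN hG hT hf.linf_pos hε0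
  have : Nonempty (Fin N) := ⟨⟨0, by omega⟩⟩
  refine ⟨hf.posDef_Ptilde hN hG hT hε0 hε1, fun t ht => ?_, fun u hu => hT.isTrajectory_Vmat hN hu,
    hf.isContractive_projField hN hG hT hε0 hε1, fun β hβ0 hβ xs νs hopt u hu => ?_⟩
  · obtain ⟨v, hv⟩ := hf.exists_isOptimizer ht
    exact ⟨v, hv, fun w hw => hf.isOptimizer_unique ht hv hw,
      hf.exists_isDualOptimizer ht hN hG hT hv⟩
  · intro err c ρ
    have key : ∀ t : ℝ, 0 ≤ t → err t ≤ (err 0 - ρ / c) * Real.exp (-c * t) + ρ / c :=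
      fun t ht => hf.tracking hN hG hT hε0 hε1 hβ0 hβ hopt (hT.isTrajectory_Vmat hN hu) ht
    exact ⟨key, fun η hη => TVDistOpt.eventually_le_of_le_exp hc key hη⟩
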